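/- **Setting.** Let $p\ge 1$, $d\ge 0$ be integers, $\beta^\star\in\mathbb R^p$, $\sigma\in\mathbb R$, $\rho\in(0,1]$. Let $Z\sim\mathcal N(0,I_p)$, let $W_1,\dots,W_d$ be i.i.d. uniform on the unit sphere $\mathbb S^{p-1}$, let $\epsilon\sim\mathcal N(0,\sigma^2)$, and let $P=(P_1,\dots,P_d)\in\{0,1\}^d$ have i.i.d. components with $\mathbb P(P_j=1)=\rho$; assume that $Z$, $W=(W_1,\dots,W_d)$, $\epsilon$ and $P$ are mutually independent. Put $X_j=Z^\top W_j$ for $1\le j\le d$, $Y=Z^\top\beta^\star+\epsilon$ and $\tilde X=P\odot X$ (missing entries imputed by zero). Define $$R^\star(d)=\inf_f\mathbb E[(Y-f(X))^2\mid W],\qquad R^\star_{\rm miss}(d)=\inf_f\mathbb E[(Y-f(\tilde X,P))^2\mid W],\qquad R^\star_{\rm imp}(d)=\inf_{\theta\in\mathbb R^d}\mathbb E[(Y-\tilde X^\top\theta)^2\mid W],$$ where the first two infima are over measurable functions $f$ (for each value of $W$, under the conditional distribution given $W$), and $$\Delta_{\rm miss}(d)=\mathbb E[R^\star_{\rm miss}(d)-R^\star(d)],\qquad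 \Delta_{\rm imp/miss}(d)=\mathbb E[R^\star_{\rm imp}(d)-R^\star_{\rm miss}(d)].$$ **Theorem.** The three risks $R^\star(d)$, $R^\star_{\rm miss}(d)$, $R^\star_{\rm imp}(d)$ are (almost everywhere) measurable with finite expectation. Moreover, with the convention that a fraction whose denominator vanishes is read as $0$: 1. If $d<p$, then $$\mathbb E[R^\star_{\rm imp}(d)]-\sigma^2\le\inf_{0\le k\le d}\left\{\frac{p-\rho k}{p}+\frac{(1-\rho)\rho(k-1)}{p-\rho(k-1)-2}\,\frac kp\right\}\|\beta^\star\|_2^2,$$ and $$\Delta_{\rm imp/miss}(d)\le\frac{(1-\rho)\rho(d-1)}{p-\rho(d-1)-2}\,\frac dp\,\|\beta^\star\|_2^2=\frac{\rho(d-1)}{p-\rho(d-1)-2}\,\Delta_{\rm miss}(d).$$ 2. If $d\ge p$, then $$\mathbb E[R^\star_{\rm imp}(d)]-\sigma^2\le\frac{p}{\rho d+(1-\rho)p}\|\beta^\star\|_2^2,$$ and $$\frac{(1-\rho)p}{\rho d+(1-\rho)p}\|\beta^\star\|_2^2\le\Delta_{\rm imp/miss}(d)+\Delta_{\rm miss}(d)\le\frac{p}{\rho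 d+(1-\rho)p}\|\beta^\star\|_2^2.$$ -/

import Mathlib

open MeasureTheory ProbabilityTheory
open scoped ENNReal

noncomputable section

namespace RFImputation

/-- The uniform probability distribution on the unit sphere of `ℝ^p`, as a measure on `ℝ^p`:
the normalized surface measure. -/
def uniformSphere (p : ℕ) : Measure (EuclideanSpace ℝ (Fin p)) :=
  (((volume : Measure (EuclideanSpace ℝ (Fin p))).toSphere Set.univ)⁻¹ •
    (volume : Measure (EuclideanSpace ℝ (Fin p))).toSphere).map Subtype.val

section Model

variable {Ω : Type*} {p d : ℕ}

/-- The random features `X_j = Zᵀ W_j`. -/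
def features (Z : Ω → EuclideanSpace ℝ (Fin p)) (W : Ω → Fin d → EuclideanSpace ℝ (Fin p)) :
    Ω → Fin d → ℝ :=
  fun ω j => inner ℝ (Z ω) (W ω j)

/-- The output `Y = Zᵀ β + ε`. -/
def output (Z : Ω → EuclideanSpace ℝ (Fin p)) (β : EuclideanSpace ℝ (Fin p)) (ε : Ω → ℝ) :
    Ω → ℝ :=
  fun ω => inner ℝ (Z ω) β + ε ω

/-- The zero-imputed features: `X_j` is kept where `P_j = 1` (`true`) and replaced by `0` where
`P_j = 0` (`false`). -/
def imputed (X : Ω → Fin d → ℝ) (P : Ω → Fin d → Bool) : Ω → Fin d → ℝ :=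
  fun ω j => if P ω j = true then X ω j else 0

/-- The Gaussian random features model with a well specified latent linear output and a
missing-completely-at-random Bernoulli mask: `Z ∼ N(0, I_p)`; `W_1, …, W_d` i.i.d. uniform on the
sphere; `ε ∼ N(0, σ²)`; `P_1, …, P_d` i.i.d. Bernoulli(`ρ`); and `Z`, `W`, `ε`, `P` are mutually
independent. -/
structure IsGaussianRFModel [MeasurableSpace Ω] (μ : Measure Ω)
    (Z : Ω → EuclideanSpace ℝ (Fin p)) (W : Ω → Fin d → EuclideanSpace ℝ (Fin p))
    (ε : Ω → ℝ) (P : Ω → Fin d → Bool) (σ ρ : ℝ) : Prop where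
  latent_law : HasLaw Z (stdGaussian (EuclideanSpace ℝ (Fin p))) μ
  weights_law : ∀ j, HasLaw (fun ω => W ω j) (uniformSphere p) μ
  weights_iIndep : iIndepFun (fun j ω => W ω j) μ
  noise_law : HasLaw ε (gaussianReal 0 (σ ^ 2).toNNReal) μ
  mask_aemeasurable : AEMeasurable P μ
  mask_prob : ∀ j, μ.real {ω | P ω j = true} = ρ
  mask_iIndep : iIndepFun (fun j ω => P ω j) μ
  latent_indep : IndepFun Z W μ
  noise_indep : IndepFun ε (fun ω => (Z ω, W ω)) μ
  mask_indep : IndepFun P (fun ω => (Z ω, W ω, ε ω)) μ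

end Model

section Risk

variable {Ω : Type*} [MeasurableSpace Ω] (μ : Measure Ω) [IsFiniteMeasure μ] {p d : ℕ}

/-- The conditional quadratic risk `E[(Y - f(V))² | W = w]`, an extended nonnegative number,
computed with the regular conditional distribution of `(V, Y)` given `W`. -/
def condRisk {E F : Type*} [MeasurableSpace E] [StandardBorelSpace E] [Nonempty E]
    [MeasurableSpace F] (V : Ω → E) (Y : Ω → ℝ) (W : Ω → F) (f : E → ℝ) (w : F) : ℝ≥0∞ :=
  ∫⁻ q, ENNReal.ofReal ((q.2 - f q.1) ^ 2) ∂(condDistrib (fun ω => (V ω, Y ω)) W μ w)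

/-- The conditional Bayes risk `inf_f E[(Y - f(V))² | W = w]`, over all measurable `f`. -/
def condBayesRisk {E F : Type*} [MeasurableSpace E] [StandardBorelSpace E] [Nonempty E]
    [MeasurableSpace F] (V : Ω → E) (Y : Ω → ℝ) (W : Ω → F) (w : F) : ℝ≥0∞ :=
  ⨅ (f : E → ℝ) (_ : Measurable f), condRisk μ V Y W f w

/-- The conditional risk `inf_θ E[(Y - Vᵀ θ)² | W = w]` of the best linear predictor. -/
def condLinearRisk {F : Type*} [MeasurableSpace F]
    (V : Ω → Fin d → ℝ) (Y : Ω → ℝ) (W : Ω → F) (w : F) : ℝ≥0∞ :=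
  ⨅ θ : Fin d → ℝ, condRisk μ V Y W (fun x => x ⬝ᵥ θ) w

variable (Z : Ω → EuclideanSpace ℝ (Fin p)) (W : Ω → Fin d → EuclideanSpace ℝ (Fin p))
  (ε : Ω → ℝ) (P : Ω → Fin d → Bool) (β : EuclideanSpace ℝ (Fin p))

/-- `R⋆(d)`, the Bayes risk given the complete features, as a random variable through `W`. -/
def riskComplete : Ω → ℝ≥0∞ :=
  fun ω => condBayesRisk μ (features Z W) (output Z β ε) W (W ω)

/-- `R⋆_miss(d)`, the Bayes risk given the incomplete features and the mask. -/
def riskMiss : Ω → ℝ≥0∞ :=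
  fun ω => condBayesRisk μ (fun ω' => (imputed (features Z W) P ω', P ω')) (output Z β ε) W (W ω)

/-- `R⋆_imp(d)`, the risk of the best linear predictor on the zero-imputed features. -/
def riskImp : Ω → ℝ≥0∞ :=
  fun ω => condLinearRisk μ (imputed (features Z W) P) (output Z β ε) W (W ω)

/-- `Δ_miss(d) = E[R⋆_miss(d) - R⋆(d)]`. -/
def deltaMiss : ℝ :=
  ∫ ω, ((riskMiss μ Z W ε P β ω).toReal - (riskComplete μ Z W ε β ω).toReal) ∂μ

/-- `Δ_imp/miss(d) = E[R⋆_imp(d) - R⋆_miss(d)]`. -/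
def deltaImpMiss : ℝ :=
  ∫ ω, ((riskImp μ Z W ε P β ω).toReal - (riskMiss μ Z W ε P β ω).toReal) ∂μ

/-- A nonnegative extended random variable is measurable (almost everywhere) with finite
expectation; in particular it is almost surely finite and its real version is integrable. -/
def HasFiniteExpectation (R : Ω → ℝ≥0∞) : Prop :=
  AEMeasurable R μ ∧ ∫⁻ ω, R ω ∂μ ≠ ⊤

end Risk

end RFImputation

end

/-! Fix the weights `w`. A linear predictor with coefficients `θ` has risk `‖β - ∑ θ j • w j‖² +
σ²`, so each of the three risks becomes a least-squares quantity. With complete features no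
measurable predictor beats the linear ones: reflecting `Z` in the span of the weights and negating
`ε` preserves their law and every feature, but flips the part of `Y` that the features miss
(`le_lintegral_sub_sq`). So `R⋆` is the squared distance from `β` to the span, plus `σ²`. `R⋆_miss`
averages the analogous distance over masks. For `R⋆_imp`, the second moments of the mask turn least
squares into ridge regression with penalty `(1 - ρ) / ρ` in the variable `α = ρ θ`
(`integral_norm_sq_sub_masked`).

Rotation invariance then gives the means. A quadratic functional has the same mean in all
directions, hence `‖β‖² / p` times the mean of its trace (`integral_weightsLaw_isotropic`). As at
most `p` random weights are almost surely independent, the mean squared distance to the span of `k ≤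
p` of them is `(p - k) / p * ‖β‖²`; this gives `Δ_miss = (1 - ρ) d / p * ‖β‖²` for `d ≤ p`.

The ridge minimum is bounded above by test vectors: shrunken coefficients of the projection of `β`
(`ridgeBound_minNorm`) below dimension `p`, and the gradient step `α j = c ⟪β, w j⟫`
(`ridgeBound_gradient`) above it. The former requires the mean inverse squared distance of a weight
to the span of the others, obtained from a Gaussian integral. The lower bound is a dual one, by
completing squares (`ridge_ge`). The shrinkage, step and dual constants `c` optimise the resulting
means. -/

noncomputable section

namespace RFImputation

/-! ### Polar coordinates -/

section Polar

variable {E : Type*} [NormedAddCommGroup E] [NormedSpace ℝ E] [MeasurableSpace E] [BorelSpace E]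
  [FiniteDimensional ℝ E] [Nontrivial E]

/-- Integration in polar coordinates of a function of the direction times a function of the
norm. -/
lemma lintegral_direction_mul_norm (μ : Measure E) [μ.IsAddHaarMeasure] {F : E → ℝ≥0∞}
    {g : ℝ → ℝ≥0∞} (hF : Measurable F) (hg : Measurable g) :
    ∫⁻ x, F (‖x‖⁻¹ • x) * g ‖x‖ ∂μ =
      (∫⁻ u : Metric.sphere (0 : E) 1, F u ∂μ.toSphere) *
        ∫⁻ r : Set.Ioi (0 : ℝ), g r ∂(Measure.volumeIoiPow (Module.finrank ℝ E - 1)) := by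
  have hm : Measurable fun u : Metric.sphere (0 : E) 1 => F u := hF.comp measurable_subtype_coe
  have hg' : Measurable fun r : Set.Ioi (0 : ℝ) => g r := hg.comp measurable_subtype_coe
  rw [← lintegral_prod_mul hm.aemeasurable hg'.aemeasurable,
    ← μ.measurePreserving_homeomorphUnitSphereProd.lintegral_comp_emb
      (Homeomorph.measurableEmbedding _)]
  simp only [homeomorphUnitSphereProd_apply_fst_coe, homeomorphUnitSphereProd_apply_snd_coe]
  rw [lintegral_subtype_comap (measurableSet_singleton (0 : E)).compl
    (fun x : E => F (‖x‖⁻¹ • x) * g ‖x‖), restrict_compl_singleton]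

end Polar

/-! ### Gaussian integrals of inverse square distances -/

section Gauss

variable (V : Type*) [NormedAddCommGroup V] [InnerProductSpace ℝ V] [FiniteDimensional ℝ V]
  [MeasurableSpace V] [BorelSpace V]

lemma lintegral_exp_neg_mul_sq_norm {b : ℝ} (hb : 0 < b) :
    ∫⁻ v : V, ENNReal.ofReal (Real.exp (-b * ‖v‖ ^ 2)) =
      ENNReal.ofReal ((Real.pi / b) ^ (Module.finrank ℝ V / 2 : ℝ)) := by
  rw [← GaussianFourier.integral_rexp_neg_mul_sq_norm hb, ofReal_integral_eq_lintegral_ofReal]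
  -- The Bochner integral of a nonintegrable function is `0`, whereas the closed form is positive.
  · by_contra h
    have := GaussianFourier.integral_rexp_neg_mul_sq_norm (V := V) hb
    rw [integral_undef h] at this
    exact (Real.rpow_pos_of_pos (div_pos Real.pi_pos hb) _).ne this
  · exact ae_of_all _ fun _ => (Real.exp_pos _).le

lemma lintegral_Ioi_exp_neg_mul {a : ℝ} (ha : 0 < a) :
    ∫⁻ s in Set.Ioi (0 : ℝ), ENNReal.ofReal (Real.exp (-a * s)) = ENNReal.ofReal a⁻¹ := by
  rw [← ofReal_integral_eq_lintegral_ofReal (integrableOn_exp_mul_Ioi (by linarith) 0)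
    (ae_of_all _ fun _ => (Real.exp_pos _).le), integral_exp_mul_Ioi (by linarith)]
  simp [neg_div_neg_eq]

/-- The Gaussian integral of the inverse square norm, in dimension at least three. -/
lemma lintegral_inv_sq_norm_mul_exp (hV : 2 < Module.finrank ℝ V) :
    ∫⁻ v : V, ENNReal.ofReal ((‖v‖ ^ 2)⁻¹) * ENNReal.ofReal (Real.exp (-‖v‖ ^ 2)) =
      ENNReal.ofReal (Real.pi ^ (Module.finrank ℝ V / 2 : ℝ) *
        (Module.finrank ℝ V / 2 - 1 : ℝ)⁻¹) := by
  have hV' : (2 : ℝ) < Module.finrank ℝ V := by exact_mod_cast hV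
  have : Nontrivial V := Module.nontrivial_of_finrank_pos (R := ℝ) (by omega)
  set m : ℝ := (Module.finrank ℝ V : ℝ) with hm
  -- Writing `‖v‖⁻²` as the integral of `exp (-s ‖v‖²)` over `s > 0` reduces the claim, after a
  -- swap, to pure Gaussian integrals.
  have h1 : ∀ᵐ v : V, ENNReal.ofReal ((‖v‖ ^ 2)⁻¹) * ENNReal.ofReal (Real.exp (-‖v‖ ^ 2)) =
      ∫⁻ s in Set.Ioi (0 : ℝ), ENNReal.ofReal (Real.exp (-(1 + s) * ‖v‖ ^ 2)) := by
    have : ∀ᵐ v : V, v ≠ 0 := by simp [ae_iff]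
    filter_upwards [this] with v hv
    rw [← lintegral_Ioi_exp_neg_mul (by positivity), ← lintegral_mul_const _ (by fun_prop)]
    refine lintegral_congr fun s => ?_
    rw [← ENNReal.ofReal_mul (Real.exp_pos _).le, ← Real.exp_add]
    ring_nf
  rw [lintegral_congr_ae h1, lintegral_lintegral_swap (by fun_prop)]
  have h2 : ∫⁻ s in Set.Ioi (0 : ℝ), ∫⁻ v : V, ENNReal.ofReal (Real.exp (-(1 + s) * ‖v‖ ^ 2)) =
      ∫⁻ s in Set.Ioi (0 : ℝ), ENNReal.ofReal (Real.pi ^ (m / 2)) *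
        ENNReal.ofReal ((s + 1) ^ (-(m / 2))) := by
    refine setLIntegral_congr_fun measurableSet_Ioi fun s hs => ?_
    have hs : 0 < s := hs
    rw [lintegral_exp_neg_mul_sq_norm V (by linarith), ← ENNReal.ofReal_mul (by positivity),
      Real.div_rpow Real.pi_pos.le (by linarith), Real.rpow_neg (by linarith), div_eq_mul_inv,
      add_comm]
  -- Integrability at infinity requires `m / 2 > 1`, that is, dimension at least three.
  have h3 : IntegrableOn (fun s : ℝ => (s + 1) ^ (-(m / 2))) (Set.Ioi 0) :=
    integrableOn_add_rpow_Ioi_of_lt (by linarith) (by linarith)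
  rw [h2, lintegral_const_mul _ (by fun_prop), ← ofReal_integral_eq_lintegral_ofReal h3,
    ← ENNReal.ofReal_mul (by positivity)]
  · congr 2
    have := (measurePreserving_add_right (volume : Measure ℝ) 1).setIntegral_preimage_emb
      (measurableEmbedding_addRight 1) (fun s : ℝ => s ^ (-(m / 2))) (Set.Ioi 1)
    rw [Set.preimage_add_const_Ioi, sub_self] at this
    rw [this, integral_Ioi_rpow_of_lt (by linarith) one_pos, Real.one_rpow,
      neg_div, ← div_neg, one_div]
    congr 1; ring
  · filter_upwards [ae_restrict_mem measurableSet_Ioi] with s hs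
    exact Real.rpow_nonneg (by linarith [show 0 < s from hs]) _

variable {V} in
/-- The Gaussian integral of the inverse square distance to a subspace of codimension at least
three. -/
lemma lintegral_inv_sq_norm_starProjection_mul_exp (S : Submodule ℝ V)
    (hS : 2 < Module.finrank ℝ Sᗮ) :
    ∫⁻ v : V, ENNReal.ofReal ((‖Sᗮ.starProjection v‖ ^ 2)⁻¹) *
        ENNReal.ofReal (Real.exp (-‖v‖ ^ 2)) =
      ENNReal.ofReal (Real.pi ^ (Module.finrank ℝ V / 2 : ℝ) *
        (Module.finrank ℝ Sᗮ / 2 - 1 : ℝ)⁻¹) := by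
  -- In `S × Sᗮ` the integrand is a product, and the factor on `S` is a plain Gaussian integral.
  let e : V → S × Sᗮ := fun v => WithLp.ofLp (S.orthogonalDecomposition v)
  have he : MeasurePreserving e :=
    (WithLp.volume_preserving_ofLp S Sᗮ).comp S.orthogonalDecomposition.measurePreserving
  let F : S × Sᗮ → ℝ≥0∞ := fun q => ENNReal.ofReal (Real.exp (-1 * ‖q.1‖ ^ 2)) *
    (ENNReal.ofReal ((‖q.2‖ ^ 2)⁻¹) * ENNReal.ofReal (Real.exp (-‖q.2‖ ^ 2)))
  have hF : Measurable F := by fun_prop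
  have h1 : ∀ v : V, ENNReal.ofReal ((‖Sᗮ.starProjection v‖ ^ 2)⁻¹) *
        ENNReal.ofReal (Real.exp (-‖v‖ ^ 2)) = F (e v) := by
    intro v
    have h2 : ‖v‖ ^ 2 = ‖S.orthogonalProjectionOnto v‖ ^ 2 +
        ‖Sᗮ.orthogonalProjectionOnto v‖ ^ 2 :=
      S.norm_sq_eq_add_norm_sq_projection v
    simp only [F, e, Submodule.orthogonalDecomposition_apply]
    rw [h2, mul_left_comm, ← ENNReal.ofReal_mul (Real.exp_pos _).le, ← Real.exp_add,
      Submodule.starProjection_apply, ← Submodule.coe_norm, mul_comm]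
    ring_nf
  have hfin : (Module.finrank ℝ S : ℝ) + Module.finrank ℝ Sᗮ = Module.finrank ℝ V := by
    exact_mod_cast S.finrank_add_finrank_orthogonal
  rw [lintegral_congr h1, he.lintegral_comp hF, Measure.volume_eq_prod,
    lintegral_prod_mul (f := fun a : S => ENNReal.ofReal (Real.exp (-1 * ‖a‖ ^ 2)))
      (g := fun b : Sᗮ => ENNReal.ofReal ((‖b‖ ^ 2)⁻¹) * ENNReal.ofReal (Real.exp (-‖b‖ ^ 2)))
      (by fun_prop) (by fun_prop), lintegral_exp_neg_mul_sq_norm _ one_pos,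
    lintegral_inv_sq_norm_mul_exp _ hS, ← ENNReal.ofReal_mul (by positivity), div_one, ← mul_assoc,
    ← Real.rpow_add Real.pi_pos, ← hfin]
  ring_nf

end Gauss

/-! ### The uniform distribution on the sphere -/

section Sphere

variable {p : ℕ}

/-- Averages over the sphere, computed with any radial weight on the space. -/
lemma lintegral_uniformSphere_mul (hp : 0 < p) {F : EuclideanSpace ℝ (Fin p) → ℝ≥0∞}
    {g : ℝ → ℝ≥0∞} (hF : Measurable F) (hg : Measurable g) :
    (∫⁻ u, F u ∂uniformSphere p) * ∫⁻ x : EuclideanSpace ℝ (Fin p), g ‖x‖ =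
      ∫⁻ x : EuclideanSpace ℝ (Fin p), F (‖x‖⁻¹ • x) * g ‖x‖ := by
  have : Nontrivial (EuclideanSpace ℝ (Fin p)) :=
    Module.nontrivial_of_finrank_pos (R := ℝ) (by simpa using hp)
  set s := (volume : Measure (EuclideanSpace ℝ (Fin p))).toSphere with hs
  have h0 : s Set.univ ≠ 0 := by
    exact Measure.measure_univ_ne_zero.mpr (Measure.toSphere_ne_zero _)
  have h1 := lintegral_direction_mul_norm (volume : Measure (EuclideanSpace ℝ (Fin p)))
    (F := fun _ => 1) measurable_const hg
  simp only [one_mul, lintegral_const] at h1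
  rw [lintegral_direction_mul_norm _ hF hg, h1, uniformSphere,
    lintegral_map hF measurable_subtype_coe, lintegral_smul_measure, smul_eq_mul, ← hs]
  rw [mul_comm (s Set.univ)⁻¹, mul_assoc, ← mul_assoc (s Set.univ)⁻¹,
    ENNReal.inv_mul_cancel h0 (measure_ne_top _ _), one_mul]

lemma isProbabilityMeasure_uniformSphere (hp : 0 < p) :
    IsProbabilityMeasure (uniformSphere p) := by
  have : Nontrivial (EuclideanSpace ℝ (Fin p)) :=
    Module.nontrivial_of_finrank_pos (R := ℝ) (by simpa using hp)
  refine ⟨?_⟩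
  rw [uniformSphere, Measure.map_apply measurable_subtype_coe MeasurableSet.univ]
  simp only [Set.preimage_univ, Measure.smul_apply, smul_eq_mul]
  exact ENNReal.inv_mul_cancel
    (Measure.measure_univ_ne_zero.mpr (Measure.toSphere_ne_zero _))
    (measure_ne_top _ _)

lemma ae_uniformSphere_norm_eq_one (p : ℕ) : ∀ᵐ u ∂uniformSphere p, ‖u‖ = 1 := by
  rw [uniformSphere, ae_map_iff measurable_subtype_coe.aemeasurable
    (measurableSet_eq_fun (by fun_prop) (by fun_prop))]
  exact ae_of_all _ fun u => by simp

/-- This radial factor can therefore be cancelled in `lintegral_uniformSphere_mul`, which transfers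
facts about Lebesgue measure to the sphere. -/
lemma lintegral_exp_neg_sq_norm_pos_ne_top :
    (∫⁻ x : EuclideanSpace ℝ (Fin p), ENNReal.ofReal (Real.exp (-1 * ‖x‖ ^ 2))) ≠ 0 ∧
    (∫⁻ x : EuclideanSpace ℝ (Fin p), ENNReal.ofReal (Real.exp (-1 * ‖x‖ ^ 2))) ≠ ∞ := by
  rw [lintegral_exp_neg_mul_sq_norm _ one_pos]
  exact ⟨(ENNReal.ofReal_pos.mpr (Real.rpow_pos_of_pos (by positivity) _)).ne', ENNReal.ofReal_ne_top⟩

/-- The uniform distribution on the sphere is invariant under isometries. -/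
lemma measurePreserving_uniformSphere (hp : 0 < p)
    (O : EuclideanSpace ℝ (Fin p) ≃ₗᵢ[ℝ] EuclideanSpace ℝ (Fin p)) :
    MeasurePreserving O (uniformSphere p) (uniformSphere p) := by
  refine ⟨O.continuous.measurable, Measure.ext_of_lintegral _ fun F hF => ?_⟩
  have hg : Measurable fun r : ℝ => ENNReal.ofReal (Real.exp (-1 * r ^ 2)) := by fun_prop
  rw [lintegral_map hF O.continuous.measurable]
  obtain ⟨h0, h1⟩ := lintegral_exp_neg_sq_norm_pos_ne_top (p := p)
  rw [← ENNReal.mul_left_inj h0 h1, lintegral_uniformSphere_mul hp hF hg,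
    lintegral_uniformSphere_mul hp (F := fun x => F (O x))
      (hF.comp O.continuous.measurable) hg,
    ← O.measurePreserving.lintegral_comp
      (f := fun x => F (‖x‖⁻¹ • x) * ENNReal.ofReal (Real.exp (-1 * ‖x‖ ^ 2))) (by fun_prop)]
  simp

/-- Proper subspaces are null for the uniform distribution on the sphere. -/
lemma uniformSphere_submodule (hp : 0 < p) (S : Submodule ℝ (EuclideanSpace ℝ (Fin p)))
    (hS : S ≠ ⊤) : uniformSphere p S = 0 := by
  have hg : Measurable fun r : ℝ => ENNReal.ofReal (Real.exp (-1 * r ^ 2)) := by fun_prop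
  have hm : MeasurableSet (S : Set (EuclideanSpace ℝ (Fin p))) :=
    S.closed_of_finiteDimensional.measurableSet
  obtain ⟨h0, h1⟩ := lintegral_exp_neg_sq_norm_pos_ne_top (p := p)
  have h2 : ∀ᵐ x : EuclideanSpace ℝ (Fin p), x ∉ S :=
    measure_eq_zero_iff_ae_notMem.mp <| Measure.addHaar_submodule volume S hS
  rw [← lintegral_indicator_one hm]
  refine (mul_eq_zero.mp ?_).resolve_right h0
  rw [lintegral_uniformSphere_mul hp (measurable_one.indicator hm) hg]
  refine (lintegral_congr_ae ?_).trans lintegral_zero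
  filter_upwards [h2] with x hx
  rw [Set.indicator_of_notMem, zero_mul]
  intro h
  rcases eq_or_ne x 0 with rfl | hx0
  · exact hx S.zero_mem
  · exact hx ((S.smul_mem_iff (inv_ne_zero (norm_ne_zero_iff.mpr hx0))).mp h)

/-- The average over the sphere of the inverse square distance to a subspace of codimension at least
three. -/
lemma lintegral_uniformSphere_inv_sq_norm_starProjection
    (S : Submodule ℝ (EuclideanSpace ℝ (Fin p))) (hS : 2 < Module.finrank ℝ Sᗮ) :
    ∫⁻ u, ENNReal.ofReal ((‖Sᗮ.starProjection u‖ ^ 2)⁻¹) ∂uniformSphere p =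
      ENNReal.ofReal ((p - 2) / (Module.finrank ℝ Sᗮ - 2)) := by
  have hle := Sᗮ.finrank_le
  rw [finrank_euclideanSpace_fin] at hle
  have hp : 0 < p := by omega
  have hp2 : 2 < Module.finrank ℝ (EuclideanSpace ℝ (Fin p)) := by
    rw [finrank_euclideanSpace_fin]; omega
  have : Nontrivial (EuclideanSpace ℝ (Fin p)) :=
    Module.nontrivial_of_finrank_pos (R := ℝ) (by simpa using hp)
  have hS' : (2 : ℝ) < Module.finrank ℝ Sᗮ := by exact_mod_cast hS
  have hp' : (2 : ℝ) < p := by exact_mod_cast (by omega : 2 < p)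
  -- The extra weight `r⁻²` absorbs the normalisation of `x` to the sphere, leaving two Gaussian
  -- integrals already computed.
  have hg : Measurable fun r : ℝ => ENNReal.ofReal ((r ^ 2)⁻¹) *
      ENNReal.ofReal (Real.exp (-r ^ 2)) := by fun_prop
  have key := lintegral_uniformSphere_mul (p := p) hp
    (F := fun u => ENNReal.ofReal ((‖Sᗮ.starProjection u‖ ^ 2)⁻¹)) (by fun_prop) hg
  have h1 : ∀ᵐ x : EuclideanSpace ℝ (Fin p),
      ENNReal.ofReal ((‖Sᗮ.starProjection (‖x‖⁻¹ • x)‖ ^ 2)⁻¹) * (ENNReal.ofReal ((‖x‖ ^ 2)⁻¹) *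
        ENNReal.ofReal (Real.exp (-‖x‖ ^ 2))) =
      ENNReal.ofReal ((‖Sᗮ.starProjection x‖ ^ 2)⁻¹) * ENNReal.ofReal (Real.exp (-‖x‖ ^ 2)) := by
    have : ∀ᵐ v : EuclideanSpace ℝ (Fin p), v ≠ 0 := by simp [ae_iff]
    filter_upwards [this] with x hx
    have hx' : ‖x‖ ≠ 0 := norm_ne_zero_iff.mpr hx
    rw [← mul_assoc, ← ENNReal.ofReal_mul (by positivity), map_smul, norm_smul, norm_inv,
      norm_norm, ← mul_inv, mul_pow, mul_right_comm, inv_pow, inv_mul_cancel₀ (by positivity),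
      one_mul]
  rw [lintegral_congr_ae h1, lintegral_inv_sq_norm_starProjection_mul_exp S hS,
    lintegral_inv_sq_norm_mul_exp _ hp2, finrank_euclideanSpace_fin] at key
  have hc : 0 < Real.pi ^ (p / 2 : ℝ) * (p / 2 - 1 : ℝ)⁻¹ :=
    mul_pos (Real.rpow_pos_of_pos Real.pi_pos _) (inv_pos.mpr (by linarith))
  rw [← ENNReal.mul_left_inj (by simpa using hc) ENNReal.ofReal_ne_top, key,
    ← ENNReal.ofReal_mul (div_nonneg (by linarith) (by linarith))]
  congr 1
  have : (p / 2 - 1 : ℝ) ≠ 0 := by linarith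
  have : (p - 2 : ℝ) ≠ 0 := by linarith
  have : (Module.finrank ℝ Sᗮ / 2 - 1 : ℝ) ≠ 0 := by linarith
  have : (Module.finrank ℝ Sᗮ - 2 : ℝ) ≠ 0 := by linarith
  field_simp

end Sphere

/-! ### Distance to the span of the weights -/

section Geometry

variable {p d : ℕ}

/-- The component of `x` orthogonal to all the vectors `w j`. -/
def orthPart (w : Fin d → EuclideanSpace ℝ (Fin p)) (x : EuclideanSpace ℝ (Fin p)) :
    EuclideanSpace ℝ (Fin p) :=
  (Submodule.span ℝ (Set.range w))ᗮ.starProjection x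

/-- The family `w` with the vectors outside of `T` replaced by zero. -/
def restrictTo (T : Finset (Fin d)) (w : Fin d → EuclideanSpace ℝ (Fin p)) :
    Fin d → EuclideanSpace ℝ (Fin p) :=
  fun j => if j ∈ T then w j else 0

lemma span_range_restrictTo (T : Finset (Fin d)) (w : Fin d → EuclideanSpace ℝ (Fin p)) :
    Submodule.span ℝ (Set.range (restrictTo T w)) = Submodule.span ℝ (w '' T) := by
  apply le_antisymm
  · rw [Submodule.span_le]
    rintro _ ⟨j, rfl⟩
    by_cases h : j ∈ T
    · simpa [restrictTo, h] using Submodule.subset_span (Set.mem_image_of_mem w h)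
    · simp [restrictTo, h]
  · refine Submodule.span_mono ?_
    rintro _ ⟨j, hj, rfl⟩
    exact ⟨j, by simp [restrictTo, Finset.mem_coe.mp hj]⟩

lemma measurable_restrictTo (T : Finset (Fin d)) :
    Measurable (restrictTo T : (Fin d → EuclideanSpace ℝ (Fin p)) → _) := by
  refine measurable_pi_lambda _ fun j => ?_
  unfold restrictTo
  split_ifs <;> fun_prop

lemma restrictTo_map (T : Finset (Fin d)) (w : Fin d → EuclideanSpace ℝ (Fin p))
    (O : EuclideanSpace ℝ (Fin p) ≃ₗᵢ[ℝ] EuclideanSpace ℝ (Fin p)) :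
    restrictTo T (fun j => O (w j)) = fun j => O (restrictTo T w j) := by
  ext1 j
  unfold restrictTo
  split_ifs <;> simp

variable (w : Fin d → EuclideanSpace ℝ (Fin p)) (x y : EuclideanSpace ℝ (Fin p))

lemma starProjection_add_orthPart :
    (Submodule.span ℝ (Set.range w)).starProjection x + orthPart w x = x :=
  Submodule.starProjection_add_starProjection_orthogonal _

lemma inner_orthPart_right : inner ℝ (orthPart w x) y = inner ℝ x (orthPart w y) :=
  Submodule.inner_starProjection_left_eq_right _ x y

lemma orthPart_orthPart : orthPart w (orthPart w x) = orthPart w x :=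
  Submodule.starProjection_eq_self_iff.mpr (Submodule.starProjection_apply_mem _ x)

lemma orthPart_eq_zero {x : EuclideanSpace ℝ (Fin p)}
    (hx : x ∈ Submodule.span ℝ (Set.range w)) : orthPart w x = 0 := by
  rw [orthPart, Submodule.starProjection_apply_eq_zero_iff]
  exact Submodule.le_orthogonal_orthogonal _ hx

lemma orthPart_eq_zero_iff {x : EuclideanSpace ℝ (Fin p)} :
    orthPart w x = 0 ↔ x ∈ Submodule.span ℝ (Set.range w) := by
  rw [orthPart, Submodule.starProjection_apply_eq_zero_iff, Submodule.orthogonal_orthogonal]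

lemma inner_orthPart_weight (j : Fin d) : inner ℝ (orthPart w x) (w j) = 0 := by
  rw [inner_orthPart_right, orthPart_eq_zero w (Submodule.subset_span ⟨j, rfl⟩), inner_zero_right]

lemma sum_smul_mem_span (θ : Fin d → ℝ) :
    ∑ j, θ j • w j ∈ Submodule.span ℝ (Set.range w) :=
  Submodule.sum_mem _ fun j _ => Submodule.smul_mem _ _ (Submodule.subset_span ⟨j, rfl⟩)

lemma norm_orthPart_le : ‖orthPart w x‖ ≤ ‖x‖ := Submodule.norm_starProjection_apply_le _ x

lemma norm_sq_orthPart_le_sub (θ : Fin d → ℝ) :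
    ‖orthPart w x‖ ^ 2 ≤ ‖x - ∑ j, θ j • w j‖ ^ 2 := by
  have h : orthPart w (x - ∑ j, θ j • w j) = orthPart w x := by
    rw [orthPart, map_sub, ← orthPart, ← orthPart, orthPart_eq_zero w (sum_smul_mem_span w θ),
      sub_zero]
  rw [← h]
  gcongr
  exact norm_orthPart_le _ _

lemma exists_sub_sum_eq_orthPart : ∃ θ : Fin d → ℝ, x - ∑ j, θ j • w j = orthPart w x := by
  obtain ⟨θ, hθ⟩ := (Submodule.mem_span_range_iff_exists_fun ℝ).mp
    (Submodule.starProjection_apply_mem (Submodule.span ℝ (Set.range w)) x)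
  refine ⟨θ, ?_⟩
  rw [hθ, sub_eq_iff_eq_add', starProjection_add_orthPart]

/-- An isometry carries the decomposition of `x` into a combination of the `w j` and an orthogonal
rest to one of the same kind for the rotated family. -/
lemma orthPart_map (O : EuclideanSpace ℝ (Fin p) ≃ₗᵢ[ℝ] EuclideanSpace ℝ (Fin p)) :
    orthPart (fun j => O (w j)) (O x) = O (orthPart w x) := by
  obtain ⟨θ, hθ⟩ := exists_sub_sum_eq_orthPart w x
  have h1 : O x = ∑ j, θ j • O (w j) + O (orthPart w x) := by
    rw [← hθ]; simp
  have h2 : orthPart (fun j => O (w j)) (O (orthPart w x)) = O (orthPart w x) := by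
    refine Submodule.starProjection_eq_self_iff.mpr ?_
    rw [Submodule.mem_orthogonal']
    intro u hu
    refine Submodule.span_induction ?_ (by simp) ?_ ?_ hu
    · rintro _ ⟨j, rfl⟩
      simp [inner_orthPart_weight]
    · intro a b _ _ ha hb
      simp [inner_add_right, ha, hb]
    · intro c a _ ha
      simp [inner_smul_right, ha]
  conv_lhs => rw [h1]
  rw [orthPart, map_add, ← orthPart, ← orthPart, h2,
    orthPart_eq_zero (fun j => O (w j)) (sum_smul_mem_span (fun j => O (w j)) θ), zero_add]

/-- An infimum of functions continuous in `(w, x)` is upper semicontinuous. This yields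
measurability in `w` although the projection jumps where the rank of `w` drops. -/
lemma ofReal_norm_sq_orthPart :
    ENNReal.ofReal (‖orthPart w x‖ ^ 2) =
      ⨅ θ : Fin d → ℝ, ENNReal.ofReal (‖x - ∑ j, θ j • w j‖ ^ 2) := by
  apply le_antisymm
  · exact le_iInf fun θ => ENNReal.ofReal_le_ofReal (norm_sq_orthPart_le_sub w x θ)
  · obtain ⟨θ, hθ⟩ := exists_sub_sum_eq_orthPart w x
    exact iInf_le_of_le θ (by rw [hθ])

/-- Polarisation: the coordinates of `orthPart w x` are recovered from squared norms, whose
measurability is known. -/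
lemma inner_orthPart_eq : inner ℝ (orthPart w x) y =
    (‖orthPart w (x + y)‖ ^ 2 - ‖orthPart w (x - y)‖ ^ 2) / 4 := by
  have h : inner ℝ (orthPart w x) y = inner ℝ (orthPart w x) (orthPart w y) := by
    rw [← inner_orthPart_right, orthPart_orthPart]
  have h1 : orthPart w (x + y) = orthPart w x + orthPart w y := map_add _ _ _
  have h2 : orthPart w (x - y) = orthPart w x - orthPart w y := map_sub _ _ _
  rw [h, h1, h2, norm_add_sq_real, norm_sub_sq_real]
  ring

/-- The orthogonal part depends measurably on the spanning family and on the vector. -/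
lemma measurable_orthPart :
    Measurable fun q : (Fin d → EuclideanSpace ℝ (Fin p)) × EuclideanSpace ℝ (Fin p) =>
      orthPart q.1 q.2 := by
  have h1 : Measurable fun q : (Fin d → EuclideanSpace ℝ (Fin p)) × EuclideanSpace ℝ (Fin p) =>
      ENNReal.ofReal (‖orthPart q.1 q.2‖ ^ 2) := by
    simp_rw [ofReal_norm_sq_orthPart]
    refine UpperSemicontinuous.measurable (upperSemicontinuous_iInf fun θ => ?_)
    exact (ENNReal.continuous_ofReal.comp (by fun_prop)).upperSemicontinuous
  have h2 : Measurable fun q : (Fin d → EuclideanSpace ℝ (Fin p)) × EuclideanSpace ℝ (Fin p) =>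
      ‖orthPart q.1 q.2‖ ^ 2 := by
    have h := h1.ennreal_toReal
    simpa only [ENNReal.toReal_ofReal (sq_nonneg _)] using h
  let b := EuclideanSpace.basisFun (Fin p) ℝ
  have h3 : (fun q : (Fin d → EuclideanSpace ℝ (Fin p)) × EuclideanSpace ℝ (Fin p) =>
      orthPart q.1 q.2) = fun q => ∑ i, ((‖orthPart q.1 (q.2 + b i)‖ ^ 2 -
        ‖orthPart q.1 (q.2 - b i)‖ ^ 2) / 4) • b i :=
    funext fun q => (b.sum_repr' (orthPart q.1 q.2)).symm.trans <|
      Finset.sum_congr rfl fun i _ => by rw [← inner_orthPart_eq, real_inner_comm]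
  rw [h3]
  refine Finset.measurable_sum _ fun i _ => Measurable.smul_const ?_ _
  have h4 : Measurable fun q : (Fin d → EuclideanSpace ℝ (Fin p)) × EuclideanSpace ℝ (Fin p) =>
      (q.1, q.2 + b i) := by fun_prop
  have h5 : Measurable fun q : (Fin d → EuclideanSpace ℝ (Fin p)) × EuclideanSpace ℝ (Fin p) =>
      (q.1, q.2 - b i) := by fun_prop
  exact ((h2.comp h4).sub (h2.comp h5)).div_const _

/-- The squared norms of the projections of an orthonormal basis onto a subspace add up to its
dimension. -/
lemma sum_norm_sq_starProjection {ι : Type*} [Fintype ι]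
    (b : OrthonormalBasis ι ℝ (EuclideanSpace ℝ (Fin p)))
    (K : Submodule ℝ (EuclideanSpace ℝ (Fin p))) :
    ∑ i, ‖K.starProjection (b i)‖ ^ 2 = Module.finrank ℝ K := by
  let f := stdOrthonormalBasis ℝ K
  have h : ∀ x, ‖K.starProjection x‖ ^ 2 = ∑ k, inner ℝ (f k : EuclideanSpace ℝ (Fin p)) x ^ 2 := by
    intro x
    rw [Submodule.starProjection_apply, ← Submodule.coe_norm, ← f.sum_sq_inner_right]
    refine Finset.sum_congr rfl fun k _ => ?_
    rw [Submodule.coe_inner, ← Submodule.starProjection_apply,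
      ← Submodule.inner_starProjection_left_eq_right,
      Submodule.starProjection_eq_self_iff.mpr (f k).2]
  simp_rw [h]
  rw [Finset.sum_comm]
  simp_rw [b.sum_sq_inner_left]
  have : ∀ k, ‖(f k : EuclideanSpace ℝ (Fin p))‖ = 1 := fun k => by
    rw [← Submodule.coe_norm, f.orthonormal.1]
  simp [this]

attribute [irreducible] orthPart

end Geometry

/-! ### Independent weights: resampling, general position, isotropy -/

section WeightsLaw

variable {p d : ℕ}

/-- The joint law of `d` independent uniform points of the sphere of `ℝ^p`. -/
def weightsLaw (p d : ℕ) : Measure (Fin d → EuclideanSpace ℝ (Fin p)) :=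
  Measure.pi fun _ => uniformSphere p

lemma isProbabilityMeasure_weightsLaw (hp : 0 < p) (d : ℕ) :
    IsProbabilityMeasure (weightsLaw p d) := by
  have := isProbabilityMeasure_uniformSphere hp
  unfold weightsLaw
  infer_instance

lemma measurePreserving_weightsLaw (hp : 0 < p)
    (O : EuclideanSpace ℝ (Fin p) ≃ₗᵢ[ℝ] EuclideanSpace ℝ (Fin p)) :
    MeasurePreserving (fun w j => O (w j)) (weightsLaw p d) (weightsLaw p d) := by
  have := isProbabilityMeasure_uniformSphere hp
  exact measurePreserving_pi (fun _ => uniformSphere p) (fun _ => uniformSphere p)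
    fun _ => measurePreserving_uniformSphere hp O

lemma measurePreserving_eval_weightsLaw (hp : 0 < p) (j : Fin d) :
    MeasurePreserving (fun w => w j) (weightsLaw p d) (uniformSphere p) := by
  have := isProbabilityMeasure_uniformSphere hp
  exact measurePreserving_eval (fun _ => uniformSphere p) j

/-- Resampling one of the points does not change the joint law. -/
lemma measurePreserving_update (hp : 0 < p) (j : Fin d) :
    MeasurePreserving
      (fun q : EuclideanSpace ℝ (Fin p) × (Fin d → EuclideanSpace ℝ (Fin p)) =>
        Function.update q.2 j q.1)
      ((uniformSphere p).prod (weightsLaw p d)) (weightsLaw p d) := by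
  have := isProbabilityMeasure_uniformSphere hp
  have := isProbabilityMeasure_weightsLaw hp d
  have hm : Measurable
      (fun q : EuclideanSpace ℝ (Fin p) × (Fin d → EuclideanSpace ℝ (Fin p)) =>
        Function.update q.2 j q.1) := by
    refine measurable_pi_lambda _ fun i => ?_
    by_cases h : i = j
    · subst h; simpa using measurable_fst
    · simp only [Function.update_of_ne h]; fun_prop
  refine ⟨hm, (Measure.pi_eq fun s hs => ?_).symm⟩
  rw [Measure.map_apply hm (MeasurableSet.univ_pi hs)]
  have h : (fun q : EuclideanSpace ℝ (Fin p) × (Fin d → EuclideanSpace ℝ (Fin p)) =>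
        Function.update q.2 j q.1) ⁻¹' (Set.univ.pi s) =
      s j ×ˢ (Set.univ.pi (Function.update s j Set.univ)) := by
    ext ⟨x, w⟩
    simp only [Set.mem_preimage, Set.mem_pi, Set.mem_univ, true_imp_iff, Set.mem_prod]
    constructor
    · intro h
      refine ⟨by simpa using h j, fun i => ?_⟩
      by_cases hi : i = j
      · subst hi; simp
      · simpa [Function.update_of_ne hi] using h i
    · rintro ⟨h1, h2⟩ i
      by_cases hi : i = j
      · subst hi; simpa using h1
      · simpa [Function.update_of_ne hi] using h2 i
  rw [h, Measure.prod_prod, weightsLaw, Measure.pi_pi,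
    ← Finset.mul_prod_erase _ _ (Finset.mem_univ j), ← Finset.mul_prod_erase _ _ (Finset.mem_univ j)]
  simp only [Function.update_self, measure_univ, one_mul]
  congr 1
  refine Finset.prod_congr rfl fun i hi => ?_
  rw [Function.update_of_ne (Finset.ne_of_mem_erase hi)]

lemma ae_weightsLaw_norm_eq_one (hp : 0 < p) :
    ∀ᵐ w ∂weightsLaw p d, ∀ j, ‖w j‖ = 1 :=
  ae_all_iff.mpr fun j =>
    (measurePreserving_eval_weightsLaw hp j).quasiMeasurePreserving.ae
      (ae_uniformSphere_norm_eq_one p)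

/-- This plays the role of conditioning on all weights but `w j`. -/
lemma lintegral_weightsLaw_update (hp : 0 < p) (j : Fin d)
    {F : (Fin d → EuclideanSpace ℝ (Fin p)) → ℝ≥0∞} (hF : Measurable F) :
    ∫⁻ w, F w ∂weightsLaw p d =
      ∫⁻ w, ∫⁻ x, F (Function.update w j x) ∂uniformSphere p ∂weightsLaw p d := by
  have := isProbabilityMeasure_uniformSphere hp
  have := isProbabilityMeasure_weightsLaw hp d
  have h := measurePreserving_update (d := d) hp j
  rw [← h.lintegral_comp hF]
  exact lintegral_prod_symm' (fun q => F (Function.update q.2 j q.1)) (hF.comp h.measurable)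

/-- Families all of whose subfamilies of at most `p` vectors are linearly independent. -/
def InGeneralPosition (w : Fin d → EuclideanSpace ℝ (Fin p)) : Prop :=
  ∀ T : Finset (Fin d), T.card < p → ∀ j ∉ T, w j ∉ Submodule.span ℝ (w '' T)

lemma span_image_ne_top (w : Fin d → EuclideanSpace ℝ (Fin p)) {T : Finset (Fin d)}
    (hT : T.card < p) : Submodule.span ℝ (w '' T) ≠ ⊤ := by
  intro h
  have h1 : Module.finrank ℝ (Submodule.span ℝ (w '' T)) ≤ T.card := by
    classical
    rw [← Finset.coe_image]
    exact (finrank_span_finset_le_card _).trans Finset.card_image_le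
  rw [h, finrank_top, finrank_euclideanSpace_fin] at h1
  omega

lemma restrictTo_update {T : Finset (Fin d)} {j : Fin d} (hj : j ∉ T)
    (w : Fin d → EuclideanSpace ℝ (Fin p)) (x : EuclideanSpace ℝ (Fin p)) :
    restrictTo T (Function.update w j x) = restrictTo T w := by
  ext1 i
  unfold restrictTo
  split_ifs with hi
  · rw [Function.update_of_ne (by rintro rfl; exact hj hi)]
  · rfl

lemma measurable_orthPart_restrictTo (T : Finset (Fin d)) (j : Fin d) :
    Measurable fun w : Fin d → EuclideanSpace ℝ (Fin p) => orthPart (restrictTo T w) (w j) := by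
  have h : Measurable fun w : Fin d → EuclideanSpace ℝ (Fin p) => (restrictTo T w, w j) :=
    (measurable_restrictTo T).prodMk (measurable_pi_apply j)
  exact measurable_orthPart.comp h

/-- With the other weights fixed, fewer than `p` of them span a proper subspace, which a resampled
`w j` almost surely avoids. -/
lemma ae_orthPart_restrictTo_ne_zero (hp : 0 < p) {T : Finset (Fin d)} (hT : T.card < p)
    {j : Fin d} (hj : j ∉ T) :
    ∀ᵐ w ∂weightsLaw p d, orthPart (restrictTo T w) (w j) ≠ 0 := by
  let s : Set (Fin d → EuclideanSpace ℝ (Fin p)) := {w | orthPart (restrictTo T w) (w j) = 0}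
  have hs : MeasurableSet s :=
    measurable_orthPart_restrictTo T j (measurableSet_singleton 0)
  have h0 : weightsLaw p d s = 0 := by
    rw [← lintegral_indicator_one hs,
      lintegral_weightsLaw_update hp j (measurable_one.indicator hs)]
    refine (lintegral_congr fun w => ?_).trans lintegral_zero
    have h1 : ∀ x, Function.update w j x ∈ s ↔
        x ∈ Submodule.span ℝ (Set.range (restrictTo T w)) := by
      intro x
      simp only [s, Set.mem_ofPred_eq, restrictTo_update hj, Function.update_self,
        orthPart_eq_zero_iff]
    have h2 : (fun x => s.indicator (1 : (Fin d → EuclideanSpace ℝ (Fin p)) → ℝ≥0∞) (Function.update w j x)) =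
        (Submodule.span ℝ (Set.range (restrictTo T w)) : Set (EuclideanSpace ℝ (Fin p))).indicator 1 := by
      ext x
      by_cases hx : x ∈ Submodule.span ℝ (Set.range (restrictTo T w))
      · rw [Set.indicator_of_mem ((h1 x).mpr hx), Set.indicator_of_mem hx]; rfl
      · rw [Set.indicator_of_notMem (fun h => hx ((h1 x).mp h)), Set.indicator_of_notMem hx]
    rw [h2, lintegral_indicator_one (Submodule.closed_of_finiteDimensional _).measurableSet]
    exact uniformSphere_submodule hp _ (by
      rw [span_range_restrictTo]; exact span_image_ne_top w hT)
  exact measure_eq_zero_iff_ae_notMem.mp h0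

lemma ae_inGeneralPosition (hp : 0 < p) :
    ∀ᵐ w ∂weightsLaw p d, InGeneralPosition w := by
  have h : ∀ T : Finset (Fin d), ∀ j : Fin d, ∀ᵐ w ∂weightsLaw p d, T.card < p → j ∉ T →
      orthPart (restrictTo T w) (w j) ≠ 0 := by
    intro T j
    by_cases hT : T.card < p
    · by_cases hj : j ∈ T
      · exact ae_of_all _ fun w _ h => absurd hj h
      · filter_upwards [ae_orthPart_restrictTo_ne_zero hp hT hj] with w hw _ _ using hw
    · exact ae_of_all _ fun w h => absurd h hT
  filter_upwards [ae_all_iff.mpr fun T => ae_all_iff.mpr fun j => h T j] with w hw T hT j hj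
  rw [← span_range_restrictTo, ← orthPart_eq_zero_iff]
  exact hw T j hT hj

lemma InGeneralPosition.linearIndepOn {w : Fin d → EuclideanSpace ℝ (Fin p)}
    (hw : InGeneralPosition w) (T : Finset (Fin d)) (hT : T.card ≤ p) :
    LinearIndepOn ℝ w (T : Set (Fin d)) := by
  classical
  induction T using Finset.induction_on with
  | empty => simp
  | insert j T hj ih =>
    rw [Finset.card_insert_of_notMem hj] at hT
    rw [Finset.coe_insert]
    exact (ih (by omega)).insert (hw T (by omega) j hj)

lemma InGeneralPosition.finrank_span {w : Fin d → EuclideanSpace ℝ (Fin p)}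
    (hw : InGeneralPosition w) (T : Finset (Fin d)) (hT : T.card ≤ p) :
    Module.finrank ℝ (Submodule.span ℝ (Set.range (restrictTo T w))) = T.card := by
  have h := finrank_span_eq_card (hw.linearIndepOn T hT).linearIndependent
  rw [span_range_restrictTo, Set.image_eq_range]
  simpa using h

lemma InGeneralPosition.span_eq_top {w : Fin d → EuclideanSpace ℝ (Fin p)}
    (hw : InGeneralPosition w) (hd : p ≤ d) : Submodule.span ℝ (Set.range w) = ⊤ := by
  obtain ⟨T, -, hT⟩ := Finset.exists_subset_card_eq (s := (Finset.univ : Finset (Fin d)))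
    (n := p) (by simpa using hd)
  have h := hw.finrank_span T hT.le
  rw [hT] at h
  have h2 : Submodule.span ℝ (Set.range (restrictTo T w)) = ⊤ :=
    Submodule.eq_top_of_finrank_eq (by rw [h, finrank_euclideanSpace_fin])
  rw [eq_top_iff, ← h2, span_range_restrictTo]
  exact Submodule.span_mono (Set.image_subset_range _ _)

/-- Rotation-equivariant quadratic functionals have the same mean in all directions. -/
lemma lintegral_weightsLaw_isotropic (hp : 0 < p)
    {Q : (Fin d → EuclideanSpace ℝ (Fin p)) → EuclideanSpace ℝ (Fin p) → ℝ≥0∞}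
    (hQ : ∀ x, Measurable fun w => Q w x)
    (hO : ∀ (O : EuclideanSpace ℝ (Fin p) ≃ₗᵢ[ℝ] EuclideanSpace ℝ (Fin p)) w x,
      Q (fun j => O (w j)) (O x) = Q w x)
    (hc : ∀ (c : ℝ) w x, Q w (c • x) = ENNReal.ofReal (c ^ 2) * Q w x)
    (β : EuclideanSpace ℝ (Fin p)) :
    p * ∫⁻ w, Q w β ∂weightsLaw p d = ENNReal.ofReal (‖β‖ ^ 2) *
      ∫⁻ w, ∑ i, Q w (EuclideanSpace.basisFun (Fin p) ℝ i) ∂weightsLaw p d := by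
  have key : ∀ x y : EuclideanSpace ℝ (Fin p), ‖x‖ = ‖y‖ →
      ∫⁻ w, Q w x ∂weightsLaw p d = ∫⁻ w, Q w y ∂weightsLaw p d := by
    intro x y hxy
    -- The reflection in the hyperplane orthogonal to `x - y` sends `x` to `y`.
    obtain ⟨O, rfl⟩ : ∃ O : EuclideanSpace ℝ (Fin p) ≃ₗᵢ[ℝ] EuclideanSpace ℝ (Fin p), O x = y :=
      ⟨_, Submodule.reflection_sub hxy⟩
    rw [← (measurePreserving_weightsLaw hp O).lintegral_comp (hQ (O x))]
    simp_rw [hO]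
  rw [lintegral_finsetSum _ fun i _ => hQ _, Finset.mul_sum]
  have h : ∀ i, ENNReal.ofReal (‖β‖ ^ 2) *
      ∫⁻ w, Q w (EuclideanSpace.basisFun (Fin p) ℝ i) ∂weightsLaw p d =
      ∫⁻ w, Q w β ∂weightsLaw p d := by
    intro i
    rw [← lintegral_const_mul _ (hQ _)]
    simp_rw [← hc]
    refine key _ _ ?_
    simp [norm_smul]
  simp only [h]
  simp

/-- The mean in one direction is `‖β‖² / p` times the mean of the trace `S`, which typically has a
closed form independent of the basis. -/
lemma integral_weightsLaw_isotropic (hp : 0 < p)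
    {Q : (Fin d → EuclideanSpace ℝ (Fin p)) → EuclideanSpace ℝ (Fin p) → ℝ}
    (hQ : ∀ x, Measurable fun w => Q w x) (hQ0 : ∀ w x, 0 ≤ Q w x)
    (hO : ∀ (O : EuclideanSpace ℝ (Fin p) ≃ₗᵢ[ℝ] EuclideanSpace ℝ (Fin p)) w x,
      Q (fun j => O (w j)) (O x) = Q w x)
    (hc : ∀ (c : ℝ) w x, Q w (c • x) = c ^ 2 * Q w x)
    {S : (Fin d → EuclideanSpace ℝ (Fin p)) → ℝ}
    (hS : ∀ᵐ w ∂weightsLaw p d, ∑ i, Q w (EuclideanSpace.basisFun (Fin p) ℝ i) = S w)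
    (hSi : Integrable S (weightsLaw p d))
    (β : EuclideanSpace ℝ (Fin p)) :
    Integrable (fun w => Q w β) (weightsLaw p d) ∧
      ∫ w, Q w β ∂weightsLaw p d = ‖β‖ ^ 2 / p * ∫ w, S w ∂weightsLaw p d := by
  have hp' : (0 : ℝ) < p := by exact_mod_cast hp
  have hS0 : 0 ≤ᵐ[weightsLaw p d] S := by
    filter_upwards [hS] with w hw
    rw [← hw]
    exact Finset.sum_nonneg fun i _ => hQ0 _ _
  have key := lintegral_weightsLaw_isotropic (d := d) hp
    (Q := fun w x => ENNReal.ofReal (Q w x)) (fun x => (hQ x).ennreal_ofReal)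
    (fun O w x => by rw [hO]) (fun c w x => by rw [hc, ENNReal.ofReal_mul (sq_nonneg _)]) β
  have h1 : ∫⁻ w, ∑ i, ENNReal.ofReal (Q w (EuclideanSpace.basisFun (Fin p) ℝ i)) ∂weightsLaw p d =
      ENNReal.ofReal (∫ w, S w ∂weightsLaw p d) := by
    rw [ofReal_integral_eq_lintegral_ofReal hSi hS0]
    refine lintegral_congr_ae ?_
    filter_upwards [hS] with w hw
    rw [← hw, ENNReal.ofReal_sum_of_nonneg fun i _ => hQ0 _ _]
  rw [h1, ← ENNReal.ofReal_mul (sq_nonneg _)] at key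
  have h2 : ∫⁻ w, ENNReal.ofReal (Q w β) ∂weightsLaw p d ≠ ∞ := by
    intro h
    rw [h, ENNReal.mul_top (by simpa using hp.ne')] at key
    exact ENNReal.ofReal_ne_top key.symm
  have h3 : Integrable (fun w => Q w β) (weightsLaw p d) :=
    ⟨(hQ β).aestronglyMeasurable, by
      rw [hasFiniteIntegral_iff_ofReal (ae_of_all _ fun w => hQ0 w β)]
      exact lt_top_iff_ne_top.mpr h2⟩
  refine ⟨h3, ?_⟩
  rw [← ofReal_integral_eq_lintegral_ofReal h3 (ae_of_all _ fun w => hQ0 w β),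
    ← ENNReal.ofReal_natCast, ← ENNReal.ofReal_mul hp'.le,
    ENNReal.ofReal_eq_ofReal_iff (mul_nonneg hp'.le (integral_nonneg fun w => hQ0 w β))
      (mul_nonneg (sq_nonneg _) (integral_nonneg_of_ae hS0))] at key
  rw [div_mul_eq_mul_div, eq_div_iff hp'.ne', ← key, mul_comm]

end WeightsLaw

/-! ### Moments of the weights and of projection coefficients -/

section Moments

variable {p d : ℕ}

lemma integral_weightsLaw_inner_sq (hp : 0 < p) (j : Fin d) (β : EuclideanSpace ℝ (Fin p)) :
    Integrable (fun w => inner ℝ β (w j) ^ 2) (weightsLaw p d) ∧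
      ∫ w, inner ℝ β (w j) ^ 2 ∂weightsLaw p d = ‖β‖ ^ 2 / p := by
  have := isProbabilityMeasure_weightsLaw hp d
  have h := integral_weightsLaw_isotropic (d := d) hp (Q := fun w x => inner ℝ x (w j) ^ 2)
    (fun x => by fun_prop) (fun w x => sq_nonneg _) (fun O w x => by simp)
    (fun c w x => by rw [inner_smul_left, mul_pow]; simp) (S := fun _ => 1)
    (by
      filter_upwards [ae_weightsLaw_norm_eq_one hp] with w hw
      rw [(EuclideanSpace.basisFun (Fin p) ℝ).sum_sq_inner_right, hw, one_pow])
    (integrable_const 1) β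
  simpa using h

lemma integral_uniformSphere_inner_mul (hp : 0 < p) (u v : EuclideanSpace ℝ (Fin p)) :
    ∫ x, inner ℝ u x * inner ℝ v x ∂uniformSphere p = inner ℝ u v / p := by
  -- A single point of the sphere is treated as a family indexed by `Fin 1`, so that the second
  -- moment above applies; polarisation does the rest.
  have hev := measurePreserving_eval_weightsLaw hp (0 : Fin 1)
  have h1 : ∀ u : EuclideanSpace ℝ (Fin p),
      Integrable (fun x => inner ℝ u x ^ 2) (uniformSphere p) ∧
        ∫ x, inner ℝ u x ^ 2 ∂uniformSphere p = ‖u‖ ^ 2 / p := by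
    intro u
    have hc : AEStronglyMeasurable (fun x => inner ℝ u x ^ 2) (uniformSphere p) := by fun_prop
    obtain ⟨h2, h3⟩ := integral_weightsLaw_inner_sq hp (0 : Fin 1) u
    rw [← hev.map_eq] at hc ⊢
    exact ⟨(integrable_map_measure hc hev.measurable.aemeasurable).mpr h2,
      (integral_map hev.measurable.aemeasurable hc).trans h3⟩
  have h4 : ∀ x, inner ℝ u x * inner ℝ v x =
      4⁻¹ * (inner ℝ (u + v) x ^ 2 - inner ℝ (u - v) x ^ 2) := by
    intro x
    rw [inner_add_left, inner_sub_left]; ring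
  simp_rw [h4]
  rw [integral_const_mul, integral_sub (h1 _).1 (h1 _).1, (h1 _).2, (h1 _).2,
    norm_add_sq_real, norm_sub_sq_real]
  ring

lemma integrable_weightsLaw_of_bound (hp : 0 < p)
    {F : (Fin d → EuclideanSpace ℝ (Fin p)) → ℝ} (hF : Measurable F) (C : ℝ)
    (hC : ∀ w, (∀ j, ‖w j‖ = 1) → |F w| ≤ C) : Integrable F (weightsLaw p d) := by
  have := isProbabilityMeasure_weightsLaw hp d
  refine Integrable.of_bound hF.aestronglyMeasurable C ?_
  filter_upwards [ae_weightsLaw_norm_eq_one hp] with w hw using hC w hw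

lemma abs_inner_weight_le {w : Fin d → EuclideanSpace ℝ (Fin p)} (hw : ∀ j, ‖w j‖ = 1)
    (x : EuclideanSpace ℝ (Fin p)) (j : Fin d) : |inner ℝ x (w j)| ≤ ‖x‖ := by
  simpa [hw j] using abs_real_inner_le_norm x (w j)

/-- Integrating out `w j` with `w i` fixed replaces `⟪w i, w j⟫ ⟪β, w j⟫` by `⟪w i, β⟫ / p`; what
remains is a second moment of `w i`. -/
lemma integral_weightsLaw_pair (hp : 0 < p) {i j : Fin d} (hij : i ≠ j)
    (β : EuclideanSpace ℝ (Fin p)) :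
    Integrable (fun w => inner ℝ β (w i) * (inner ℝ (w i) (w j) * inner ℝ β (w j)))
        (weightsLaw p d) ∧
      ∫ w, inner ℝ β (w i) * (inner ℝ (w i) (w j) * inner ℝ β (w j)) ∂weightsLaw p d =
        ‖β‖ ^ 2 / p ^ 2 := by
  have := isProbabilityMeasure_uniformSphere hp
  have := isProbabilityMeasure_weightsLaw hp d
  set F : (Fin d → EuclideanSpace ℝ (Fin p)) → ℝ :=
    fun w => inner ℝ β (w i) * (inner ℝ (w i) (w j) * inner ℝ β (w j)) with hFdef
  have hm : Measurable F := by fun_prop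
  have hF : Integrable F (weightsLaw p d) := by
    refine integrable_weightsLaw_of_bound hp hm (‖β‖ * (1 * ‖β‖)) fun w hw => ?_
    rw [hFdef, abs_mul, abs_mul]
    have h1 := abs_inner_weight_le hw (w i) j
    rw [hw i] at h1
    have h2 := abs_inner_weight_le hw β i
    have h3 := abs_inner_weight_le hw β j
    gcongr
  refine ⟨hF, ?_⟩
  have hu := measurePreserving_update (d := d) hp j
  rw [← hu.map_eq] at hF ⊢
  rw [integral_map hu.measurable.aemeasurable hm.aestronglyMeasurable]
  have hF' := (integrable_map_measure hm.aestronglyMeasurable hu.measurable.aemeasurable).mp hF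
  refine (integral_prod_symm _ hF').trans ?_
  simp only [Function.comp_apply]
  have h5 : ∀ w : Fin d → EuclideanSpace ℝ (Fin p),
      ∫ x, F (Function.update w j x) ∂uniformSphere p = (p : ℝ)⁻¹ * inner ℝ β (w i) ^ 2 := by
    intro w
    simp only [hFdef, Function.update_self, Function.update_of_ne hij]
    rw [integral_const_mul, integral_uniformSphere_inner_mul hp, real_inner_comm]
    ring
  simp_rw [h5]
  rw [integral_const_mul, (integral_weightsLaw_inner_sq hp i β).2]
  ring

/-- The mean squared distance of a vector to the span of `T.card ≤ p` random features. -/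
lemma integral_weightsLaw_norm_sq_orthPart (hp : 0 < p) (T : Finset (Fin d)) (hT : T.card ≤ p)
    (β : EuclideanSpace ℝ (Fin p)) :
    Integrable (fun w => ‖orthPart (restrictTo T w) β‖ ^ 2) (weightsLaw p d) ∧
      ∫ w, ‖orthPart (restrictTo T w) β‖ ^ 2 ∂weightsLaw p d = (p - T.card) / p * ‖β‖ ^ 2 := by
  have := isProbabilityMeasure_weightsLaw hp d
  have h := integral_weightsLaw_isotropic (d := d) hp
    (Q := fun w x => ‖orthPart (restrictTo T w) x‖ ^ 2)
    (fun x => by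
      have h1 : Measurable fun w : Fin d → EuclideanSpace ℝ (Fin p) => (restrictTo T w, x) :=
        (measurable_restrictTo T).prodMk measurable_const
      exact (measurable_orthPart.comp h1).norm.pow_const 2)
    (fun w x => sq_nonneg _) (fun O w x => by
      rw [restrictTo_map, orthPart_map, LinearIsometryEquiv.norm_map])
    (fun c w x => by
      rw [orthPart, map_smul, norm_smul, mul_pow, Real.norm_eq_abs, sq_abs, ← orthPart])
    -- The trace of an orthogonal projection is its rank, here `p - T.card` in general position.
    (S := fun _ => (p - T.card : ℝ))
    (by
      filter_upwards [ae_inGeneralPosition hp] with w hw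
      simp_rw [orthPart]
      rw [sum_norm_sq_starProjection]
      have h1 := (Submodule.span ℝ (Set.range (restrictTo T w))).finrank_add_finrank_orthogonal
      rw [hw.finrank_span T hT, finrank_euclideanSpace_fin] at h1
      exact eq_sub_of_add_eq' (by exact_mod_cast h1))
    (integrable_const _) β
  refine ⟨h.1, h.2.trans ?_⟩
  simp only [integral_const, probReal_univ, one_smul]
  ring

/-- The mean inverse squared distance of a random feature to the span of others. -/
lemma integral_weightsLaw_inv_norm_sq (T : Finset (Fin d)) (hT : T.card + 2 < p)
    {j : Fin d} (hj : j ∉ T) :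
    Integrable (fun w => (‖orthPart (restrictTo T w) (w j)‖ ^ 2)⁻¹) (weightsLaw p d) ∧
      ∫ w, (‖orthPart (restrictTo T w) (w j)‖ ^ 2)⁻¹ ∂weightsLaw p d =
        (p - 2) / (p - T.card - 2) := by
  have hp : 0 < p := by omega
  have := isProbabilityMeasure_weightsLaw hp d
  have hm : Measurable fun w : Fin d → EuclideanSpace ℝ (Fin p) =>
      (‖orthPart (restrictTo T w) (w j)‖ ^ 2)⁻¹ :=
    ((measurable_orthPart_restrictTo (p := p) T j).norm.pow_const 2).inv
  have hT' : (T.card + 2 : ℝ) < p := by exact_mod_cast hT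
  have h0 : (0 : ℝ) ≤ (p - 2) / (p - T.card - 2) :=
    div_nonneg (by linarith [(Nat.cast_nonneg T.card : (0 : ℝ) ≤ _)]) (by linarith)
  have h1 : ∫⁻ w, ENNReal.ofReal ((‖orthPart (restrictTo T w) (w j)‖ ^ 2)⁻¹) ∂weightsLaw p d =
      ENNReal.ofReal ((p - 2) / (p - T.card - 2)) := by
    rw [lintegral_weightsLaw_update hp j hm.ennreal_ofReal]
    simp only [restrictTo_update hj, Function.update_self]
    -- The inner integral depends on the fixed weights only through the codimension `p - T.card ≥ 3`
    -- of their span.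
    have h2 : ∀ᵐ w ∂weightsLaw p d,
        ∫⁻ x, ENNReal.ofReal ((‖orthPart (restrictTo T w) x‖ ^ 2)⁻¹) ∂uniformSphere p =
          ENNReal.ofReal ((p - 2) / (p - T.card - 2)) := by
      filter_upwards [ae_inGeneralPosition hp] with w hw
      have h3 := (Submodule.span ℝ (Set.range (restrictTo T w))).finrank_add_finrank_orthogonal
      rw [hw.finrank_span T (by omega), finrank_euclideanSpace_fin] at h3
      simp_rw [orthPart]
      rw [lintegral_uniformSphere_inv_sq_norm_starProjection _ (by omega),
        show (Module.finrank ℝ (Submodule.span ℝ (Set.range (restrictTo T w)))ᗮ : ℝ) = p - T.card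
          from eq_sub_of_add_eq' (by exact_mod_cast h3)]
    rw [lintegral_congr_ae h2]
    simp
  have h4 : Integrable (fun w => (‖orthPart (restrictTo T w) (w j)‖ ^ 2)⁻¹) (weightsLaw p d) :=
    ⟨hm.aestronglyMeasurable, by
      rw [hasFiniteIntegral_iff_ofReal (ae_of_all _ fun w => by positivity), h1]
      exact ENNReal.ofReal_lt_top⟩
  refine ⟨h4, ?_⟩
  rw [integral_eq_lintegral_of_nonneg_ae (ae_of_all _ fun w => by positivity)
    hm.aestronglyMeasurable, h1, ENNReal.toReal_ofReal h0]

/-- The mean square of a coefficient of the projection of a vector on the span of the features. -/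
lemma integral_weightsLaw_coeff_sq (T : Finset (Fin d)) (hT : T.card + 2 < p)
    {j : Fin d} (hj : j ∉ T) (β : EuclideanSpace ℝ (Fin p)) :
    Integrable (fun w => (inner ℝ β (orthPart (restrictTo T w) (w j)) /
        ‖orthPart (restrictTo T w) (w j)‖ ^ 2) ^ 2) (weightsLaw p d) ∧
      ∫ w, (inner ℝ β (orthPart (restrictTo T w) (w j)) /
        ‖orthPart (restrictTo T w) (w j)‖ ^ 2) ^ 2 ∂weightsLaw p d =
        ‖β‖ ^ 2 / p * ((p - 2) / (p - T.card - 2)) := by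
  have hp : 0 < p := by omega
  obtain ⟨h1, h2⟩ := integral_weightsLaw_inv_norm_sq T hT hj
  have hm := measurable_orthPart_restrictTo (p := p) T j
  rw [← h2]
  refine integral_weightsLaw_isotropic (d := d) hp
    (Q := fun w x => (inner ℝ x (orthPart (restrictTo T w) (w j)) /
      ‖orthPart (restrictTo T w) (w j)‖ ^ 2) ^ 2)
    (fun x => ((measurable_const.inner hm).div (hm.norm.pow_const 2)).pow_const 2)
    (fun w x => sq_nonneg _) (fun O w x => ?_) (fun c w x => ?_) (ae_of_all _ fun w => ?_) h1 β
  · rw [restrictTo_map, orthPart_map, LinearIsometryEquiv.norm_map,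
      LinearIsometryEquiv.inner_map_map]
  · rw [inner_smul_left, mul_div_assoc, mul_pow]; simp
  -- With `r` the orthogonal part of `w j`, the trace is `‖r‖² / ‖r‖⁴ = ‖r‖⁻²`; for `r = 0` both
  -- sides are `0` by convention.
  · simp_rw [div_pow]
    rw [← Finset.sum_div, (EuclideanSpace.basisFun (Fin p) ℝ).sum_sq_inner_right]
    rcases eq_or_ne (‖orthPart (restrictTo T w) (w j)‖) 0 with h | h
    · simp [h]
    · field_simp

end Moments

/-! ### Upper and lower bounds on the ridge minimum -/

section Ridge

variable {p d : ℕ}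

/-- The ridge regression objective with penalty `l`. -/
def ridge (l : ℝ) (w : Fin d → EuclideanSpace ℝ (Fin p)) (β : EuclideanSpace ℝ (Fin p))
    (α : Fin d → ℝ) : ℝ :=
  ‖β - ∑ j, α j • w j‖ ^ 2 + l * ∑ j, α j ^ 2

/-- The minimum of the ridge objective is dominated by an integrable function of mean at most
`C`. -/
def RidgeBound (d : ℕ) (l : ℝ) (β : EuclideanSpace ℝ (Fin p)) (C : ℝ) : Prop :=
  ∃ G : (Fin d → EuclideanSpace ℝ (Fin p)) → ℝ, Integrable G (weightsLaw p d) ∧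
    (∀ᵐ w ∂weightsLaw p d, ∃ α, ridge l w β α ≤ G w) ∧ ∫ w, G w ∂weightsLaw p d ≤ C

lemma ridgeBound_norm_sq (hp : 0 < p) (l : ℝ) (β : EuclideanSpace ℝ (Fin p)) :
    RidgeBound d l β (‖β‖ ^ 2) := by
  have := isProbabilityMeasure_weightsLaw hp d
  exact ⟨fun _ => ‖β‖ ^ 2, integrable_const _, ae_of_all _ fun w => ⟨0, by simp [ridge]⟩, by simp⟩

/-- The unpenalised case, needed for `ρ = 1`. -/
lemma ridgeBound_projection (hp : 0 < p) (T : Finset (Fin d)) (hT : T.card ≤ p)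
    (β : EuclideanSpace ℝ (Fin p)) : RidgeBound d 0 β ((p - T.card) / p * ‖β‖ ^ 2) := by
  obtain ⟨h1, h2⟩ := integral_weightsLaw_norm_sq_orthPart hp T hT β
  refine ⟨_, h1, ae_of_all _ fun w => ?_, h2.le⟩
  obtain ⟨θ, hθ⟩ := exists_sub_sum_eq_orthPart (restrictTo T w) β
  refine ⟨fun j => if j ∈ T then θ j else 0, ?_⟩
  rw [ridge, zero_mul, add_zero, ← hθ]
  simp [restrictTo]

lemma integral_const_add_mul_add_mul {X : Type*} [MeasurableSpace X] {ν : Measure X}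
    [IsProbabilityMeasure ν] {f g : X → ℝ} (hf : Integrable f ν) (hg : Integrable g ν)
    (a b c : ℝ) : Integrable (fun x => a + b * f x + c * g x) ν ∧
      ∫ x, a + b * f x + c * g x ∂ν = a + b * ∫ x, f x ∂ν + c * ∫ x, g x ∂ν := by
  have h1 : Integrable (fun x => a + b * f x) ν := (integrable_const _).add (hf.const_mul _)
  refine ⟨h1.add (hg.const_mul _), ?_⟩
  rw [integral_add h1 (hg.const_mul _), integral_add (integrable_const _) (hf.const_mul _),
    integral_const_mul, integral_const_mul]
  simp

/-- The ridge objective at `α j = c ⟪β, w j⟫`, `j ∈ T`. -/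
lemma ridge_inner (l c : ℝ) (w : Fin d → EuclideanSpace ℝ (Fin p))
    (β : EuclideanSpace ℝ (Fin p)) (T : Finset (Fin d)) (hw : ∀ j, ‖w j‖ = 1) :
    ridge l w β (fun j => if j ∈ T then c * inner ℝ β (w j) else 0) =
      ‖β‖ ^ 2 + (c ^ 2 * (1 + l) - 2 * c) * ∑ j ∈ T, inner ℝ β (w j) ^ 2 +
        c ^ 2 * ∑ i ∈ T, ∑ j ∈ T.erase i,
          inner ℝ β (w i) * (inner ℝ (w i) (w j) * inner ℝ β (w j)) := by
  have h1 : ∑ j, (if j ∈ T then c * inner ℝ β (w j) else 0) • w j =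
      c • ∑ j ∈ T, inner ℝ β (w j) • w j := by
    simp [ite_smul, Finset.sum_ite_mem, Finset.smul_sum, smul_smul]
  have h2 : ∑ j, (if j ∈ T then c * inner ℝ β (w j) else 0) ^ 2 =
      c ^ 2 * ∑ j ∈ T, inner ℝ β (w j) ^ 2 := by
    simp [ite_pow, Finset.sum_ite_mem, Finset.mul_sum, mul_pow]
  have h3 : inner ℝ β (c • ∑ j ∈ T, inner ℝ β (w j) • w j) =
      c * ∑ j ∈ T, inner ℝ β (w j) ^ 2 := by
    simp [inner_smul_right, inner_sum, sq]
  have h4 : ‖∑ j ∈ T, inner ℝ β (w j) • w j‖ ^ 2 = ∑ j ∈ T, inner ℝ β (w j) ^ 2 +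
      ∑ i ∈ T, ∑ j ∈ T.erase i,
        inner ℝ β (w i) * (inner ℝ (w i) (w j) * inner ℝ β (w j)) := by
    rw [← real_inner_self_eq_norm_sq, sum_inner, ← Finset.sum_add_distrib]
    refine Finset.sum_congr rfl fun i hi => ?_
    rw [inner_sum, ← Finset.add_sum_erase _ _ hi]
    congr 1
    · rw [real_inner_smul_left, real_inner_smul_right, real_inner_self_eq_norm_sq, hw]; ring
    · refine Finset.sum_congr rfl fun j _ => ?_
      rw [real_inner_smul_left, real_inner_smul_right]; ring
  rw [ridge, h1, h2, norm_sub_sq_real, h3, norm_smul, mul_pow, h4, Real.norm_eq_abs, sq_abs]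
  ring

/-- In the mean of `ridge_inner`, each of the `T.card` diagonal terms contributes `‖β‖² / p` and
each of the `T.card * (T.card - 1)` ordered pairs `‖β‖² / p²`. -/
lemma ridgeBound_inner (hp : 0 < p) (l c : ℝ) (T : Finset (Fin d))
    (β : EuclideanSpace ℝ (Fin p)) :
    RidgeBound d l β ((1 + (c ^ 2 * (1 + l) - 2 * c) * (T.card / p) +
      c ^ 2 * (T.card * (T.card - 1) / p ^ 2)) * ‖β‖ ^ 2) := by
  have := isProbabilityMeasure_weightsLaw hp d
  have i1 : Integrable (fun w => ∑ j ∈ T, inner ℝ β (w j) ^ 2) (weightsLaw p d) :=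
    integrable_finsetSum _ fun j _ => (integral_weightsLaw_inner_sq hp j β).1
  have i2 : ∀ i ∈ T, ∀ j ∈ T.erase i, Integrable (fun w =>
      inner ℝ β (w i) * (inner ℝ (w i) (w j) * inner ℝ β (w j))) (weightsLaw p d) :=
    fun i _ j hj => (integral_weightsLaw_pair hp (Finset.ne_of_mem_erase hj).symm β).1
  have i3 : Integrable (fun w => ∑ i ∈ T, ∑ j ∈ T.erase i,
      inner ℝ β (w i) * (inner ℝ (w i) (w j) * inner ℝ β (w j))) (weightsLaw p d) :=
    integrable_finsetSum _ fun i hi => integrable_finsetSum _ fun j hj => i2 i hi j hj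
  have e1 : ∫ w, ∑ j ∈ T, inner ℝ β (w j) ^ 2 ∂weightsLaw p d = T.card * (‖β‖ ^ 2 / p) := by
    rw [integral_finsetSum _ fun j _ => (integral_weightsLaw_inner_sq hp j β).1]
    simp [(integral_weightsLaw_inner_sq hp _ β).2]
  have e3 : ∫ w, ∑ i ∈ T, ∑ j ∈ T.erase i,
      inner ℝ β (w i) * (inner ℝ (w i) (w j) * inner ℝ β (w j)) ∂weightsLaw p d =
      T.card * ((T.card - 1) * (‖β‖ ^ 2 / p ^ 2)) := by
    rw [integral_finsetSum _ fun i hi => integrable_finsetSum _ fun j hj => i2 i hi j hj]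
    have h : ∀ i ∈ T, ∫ w, ∑ j ∈ T.erase i,
        inner ℝ β (w i) * (inner ℝ (w i) (w j) * inner ℝ β (w j)) ∂weightsLaw p d =
        (T.card - 1) * (‖β‖ ^ 2 / p ^ 2) := by
      intro i hi
      rw [integral_finsetSum _ fun j hj => i2 i hi j hj, Finset.sum_congr rfl fun j hj =>
        (integral_weightsLaw_pair hp (Finset.ne_of_mem_erase hj).symm β).2, Finset.sum_const,
        nsmul_eq_mul, Finset.card_erase_of_mem hi, Nat.cast_pred (Finset.card_pos.mpr ⟨i, hi⟩)]
    rw [Finset.sum_congr rfl h, Finset.sum_const, nsmul_eq_mul]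
  obtain ⟨i4, e4⟩ := integral_const_add_mul_add_mul i1 i3 (‖β‖ ^ 2) (c ^ 2 * (1 + l) - 2 * c)
    (c ^ 2)
  refine ⟨_, i4, ?_, ?_⟩
  · filter_upwards [ae_weightsLaw_norm_eq_one hp] with w hw
    exact ⟨_, (ridge_inner l c w β T hw).le⟩
  · rw [e4, e1, e3]
    apply le_of_eq
    ring

/-- Bound on the ridge regression error for features indexed by `T`, through an explicit
one-step gradient predictor. -/
lemma ridgeBound_gradient (hp : 0 < p) {ρ : ℝ} (hρ0 : 0 < ρ)
    (T : Finset (Fin d)) (β : EuclideanSpace ℝ (Fin p)) :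
    RidgeBound d ((1 - ρ) / ρ) β
      ((1 - ρ * T.card / (p + ρ * (T.card - 1))) * ‖β‖ ^ 2) := by
  have hp' : (1 : ℝ) ≤ p := by exact_mod_cast hp
  -- For empty `T` the denominator is `p - ρ`, which need not be positive here.
  rcases T.card.eq_zero_or_pos with h0 | h0
  · simpa [h0] using ridgeBound_norm_sq (d := d) hp ((1 - ρ) / ρ) β
  have hT : (1 : ℝ) ≤ T.card := by exact_mod_cast h0
  have hD : 0 < p + ρ * (T.card - 1) := by nlinarith
  -- As `1 + l = 1 / ρ`, this `c` minimises the quadratic in `ridgeBound_inner`.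
  have h := ridgeBound_inner hp ((1 - ρ) / ρ) (p * ρ / (p + ρ * (T.card - 1))) T β
  convert h using 2
  field_simp
  ring

/-- In general position, the coefficients of the projection of `β` on the span of the features. -/
lemma InGeneralPosition.sum_coeff_smul {w : Fin d → EuclideanSpace ℝ (Fin p)}
    (hw : InGeneralPosition w) (T : Finset (Fin d)) (hT : T.card ≤ p)
    (β : EuclideanSpace ℝ (Fin p)) :
    ∑ j ∈ T, (inner ℝ β (orthPart (restrictTo (T.erase j) w) (w j)) /
        ‖orthPart (restrictTo (T.erase j) w) (w j)‖ ^ 2) • w j =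
      β - orthPart (restrictTo T w) β := by
  obtain ⟨a, ha⟩ := exists_sub_sum_eq_orthPart (restrictTo T w) β
  have ha' : ∑ j, a j • restrictTo T w j = ∑ j ∈ T, a j • w j := by
    simp [restrictTo]
  rw [ha'] at ha
  rw [← ha, sub_sub_cancel]
  refine Finset.sum_congr rfl fun j hj => ?_
  congr 1
  -- `r` is orthogonal to the other weights of `T` and to the residual of `β`, so pairing `β` with
  -- `r` isolates the coefficient `a j`.
  set r := orthPart (restrictTo (T.erase j) w) (w j) with hr
  have hr0 : r ≠ 0 := by
    rw [hr, ne_eq, orthPart_eq_zero_iff, span_range_restrictTo]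
    refine hw _ ?_ _ (Finset.notMem_erase j T)
    rw [Finset.card_erase_of_mem hj]
    have := Finset.card_pos.mpr ⟨j, hj⟩
    omega
  have h1 : ∀ i ∈ T, i ≠ j → inner ℝ (w i) r = 0 := by
    intro i hi hij
    have := inner_orthPart_weight (restrictTo (T.erase j) w) (w j) i
    rw [real_inner_comm]
    simpa [restrictTo, hi, hij] using this
  have h2 : inner ℝ (w j) r = ‖r‖ ^ 2 := by
    rw [hr, ← real_inner_self_eq_norm_sq, inner_orthPart_right, orthPart_orthPart]
  have h3 : inner ℝ (orthPart (restrictTo T w) β) r = 0 := by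
    have h4 : r ∈ Submodule.span ℝ (Set.range (restrictTo T w)) := by
      obtain ⟨b, hb⟩ := exists_sub_sum_eq_orthPart (restrictTo (T.erase j) w) (w j)
      rw [hr, ← hb, span_range_restrictTo]
      refine Submodule.sub_mem _ (Submodule.subset_span ⟨j, hj, rfl⟩) ?_
      refine Submodule.sum_mem _ fun i _ => Submodule.smul_mem _ _ ?_
      by_cases hi : i ∈ T.erase j
      · simp only [restrictTo, hi, if_true]
        exact Submodule.subset_span ⟨i, Finset.mem_of_mem_erase hi, rfl⟩
      · simp [restrictTo, hi]
    rw [inner_orthPart_right, orthPart_eq_zero _ h4, inner_zero_right]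
  have h5 : inner ℝ β r = a j * ‖r‖ ^ 2 := by
    have h6 : β = ∑ j ∈ T, a j • w j + orthPart (restrictTo T w) β := by rw [← ha]; abel
    rw [h6, inner_add_left, h3, add_zero, sum_inner, Finset.sum_eq_single_of_mem j hj]
    · rw [real_inner_smul_left, h2]
    · intro i hi hij
      rw [real_inner_smul_left, h1 i hi hij, mul_zero]
  rw [h5, mul_div_cancel_right₀ _ (by simpa using hr0)]

/-- Bound on the ridge regression error for features indexed by `T`, through a shrunken
minimum-norm interpolation. -/
lemma ridgeBound_minNorm (l c : ℝ) (T : Finset (Fin d)) (hT : T.card + 1 < p)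
    (β : EuclideanSpace ℝ (Fin p)) :
    RidgeBound d l β (((p - T.card) / p + (1 - c) ^ 2 * (T.card / p) +
      l * c ^ 2 * (T.card / p * ((p - 2) / (p - T.card - 1)))) * ‖β‖ ^ 2) := by
  have hp : 0 < p := by omega
  have hp' : (p : ℝ) ≠ 0 := by exact_mod_cast hp.ne'
  have := isProbabilityMeasure_weightsLaw hp d
  obtain ⟨i1, e1⟩ := integral_weightsLaw_norm_sq_orthPart hp T (by omega) β
  -- Only `T.card - 1` weights remain once `j` is removed, so `T.card + 1 < p` is exactly the
  -- condition that their span has codimension at least three.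
  have hc : ∀ j ∈ T, (T.erase j).card + 2 < p ∧ ((T.erase j).card : ℝ) = T.card - 1 := by
    intro j hj
    have := Finset.card_pos.mpr ⟨j, hj⟩
    rw [Finset.card_erase_of_mem hj]
    exact ⟨by omega, Nat.cast_pred this⟩
  have i2 := fun j hj => (integral_weightsLaw_coeff_sq (T.erase j) (hc j hj).1
    (Finset.notMem_erase j T) β).1
  have i3 := integrable_finsetSum T i2
  have e3 : ∫ w, ∑ j ∈ T, (inner ℝ β (orthPart (restrictTo (T.erase j) w) (w j)) /
        ‖orthPart (restrictTo (T.erase j) w) (w j)‖ ^ 2) ^ 2 ∂weightsLaw p d =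
      T.card * (‖β‖ ^ 2 / p * ((p - 2) / (p - T.card - 1))) := by
    rw [integral_finsetSum _ i2, Finset.sum_congr rfl (g := fun _ =>
      (‖β‖ ^ 2 / p * ((p - 2) / (p - T.card - 1)))), Finset.sum_const, nsmul_eq_mul]
    intro j hj
    rw [(integral_weightsLaw_coeff_sq (T.erase j) (hc j hj).1 (Finset.notMem_erase j T) β).2,
      (hc j hj).2]
    ring_nf
  -- Shrinking the projection of `β` by `c` leaves the squared residual `(1 - c)² ‖β‖² + (1 - (1 -
  -- c)²) ‖r‖²`, where `r` is the residual of `β`; the last term is the penalty.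
  obtain ⟨i4, e4⟩ := integral_const_add_mul_add_mul i1 i3 ((1 - c) ^ 2 * ‖β‖ ^ 2)
    (1 - (1 - c) ^ 2) (l * c ^ 2)
  refine ⟨_, i4, ?_, ?_⟩
  · filter_upwards [ae_inGeneralPosition hp] with w hw
    have hs := hw.sum_coeff_smul T (by omega) β
    set a : Fin d → ℝ := fun j => inner ℝ β (orthPart (restrictTo (T.erase j) w) (w j)) /
        ‖orthPart (restrictTo (T.erase j) w) (w j)‖ ^ 2 with ha
    refine ⟨fun j => if j ∈ T then c * a j else 0, le_of_eq ?_⟩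
    have h1 : ∑ j, (if j ∈ T then c * a j else 0) • w j = c • ∑ j ∈ T, a j • w j := by
      simp [ite_smul, Finset.sum_ite_mem, Finset.smul_sum, smul_smul]
    have h2 : ∑ j, (if j ∈ T then c * a j else 0) ^ 2 = c ^ 2 * ∑ j ∈ T, a j ^ 2 := by
      simp [ite_pow, Finset.sum_ite_mem, Finset.mul_sum, mul_pow]
    have h3 : inner ℝ β (orthPart (restrictTo T w) β) = ‖orthPart (restrictTo T w) β‖ ^ 2 := by
      rw [← real_inner_self_eq_norm_sq, inner_orthPart_right, orthPart_orthPart]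
    have h4 : β - c • (β - orthPart (restrictTo T w) β) =
        (1 - c) • β + c • orthPart (restrictTo T w) β := by module
    rw [ridge, h1, h2, hs, h4, norm_add_sq_real, norm_smul, norm_smul, mul_pow, mul_pow,
      Real.norm_eq_abs, Real.norm_eq_abs, sq_abs, sq_abs, real_inner_smul_left,
      real_inner_smul_right, h3]
    ring
  · rw [e4, e1, e3]
    apply le_of_eq
    field_simp
    ring

lemma ridgeBound_shrunken {ρ : ℝ} (hρ0 : 0 < ρ) (hρ1 : ρ ≤ 1)
    (T : Finset (Fin d)) (hT : T.card + 1 < p) (β : EuclideanSpace ℝ (Fin p)) :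
    RidgeBound d ((1 - ρ) / ρ) β
      (((p - ρ * T.card) / p + (1 - ρ) * ρ * (T.card - 1) / (p - ρ * (T.card - 1) - 2) *
        (T.card / p)) * ‖β‖ ^ 2) := by
  have hT' : (T.card + 1 : ℝ) < p := by exact_mod_cast hT
  have hT0 : (0 : ℝ) ≤ T.card := Nat.cast_nonneg _
  have hp2 : (2 : ℝ) ≤ p := by exact_mod_cast (by omega : 2 ≤ p)
  have h1 : 0 < (p : ℝ) - T.card - 1 := by linarith
  have hD : 0 < (p : ℝ) - ρ * (T.card - 1) - 2 := by nlinarith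
  -- This shrinkage minimises `(1 - c)² + l c² (p - 2) / (p - T.card - 1)`.
  have h := ridgeBound_minNorm ((1 - ρ) / ρ)
    (ρ * (p - T.card - 1) / (p - ρ * (T.card - 1) - 2)) T hT β
  convert h using 2
  have : (p : ℝ) ≠ 0 := by linarith
  field_simp
  ring

/-- The first bound, below the dimension of the latent space. -/
lemma ridgeBound_of_lt {ρ : ℝ} (hρ0 : 0 < ρ) (hρ1 : ρ ≤ 1) (β : EuclideanSpace ℝ (Fin p))
    {k : ℕ} (hkd : k ≤ d) (hkp : k < p) :
    RidgeBound d ((1 - ρ) / ρ) β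
      (((p - ρ * k) / p + (1 - ρ) * ρ * (k - 1) / (p - ρ * (k - 1) - 2) *
        (k / p)) * ‖β‖ ^ 2) := by
  have hp : 0 < p := by omega
  have hp' : (0 : ℝ) < p := by exact_mod_cast hp
  obtain ⟨T, -, rfl⟩ := Finset.exists_subset_card_eq (s := (Finset.univ : Finset (Fin d)))
    (n := k) (by simpa using hkd)
  -- At `ρ = 1` the penalty and the second term of the bound vanish, whatever the denominator, and
  -- plain projection suffices.
  rcases eq_or_lt_of_le hρ1 with rfl | hρ
  · have h := ridgeBound_projection hp T (by omega) β
    simpa using h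
  -- For at most one weight the second term of the bound is `0`, and the gradient step already gives
  -- `1 - ρ k / p`.
  by_cases hk1 : T.card ≤ 1
  · have h := ridgeBound_gradient hp hρ0 T β
    interval_cases hk : T.card
    · simpa [hp'.ne'] using h
    · convert h using 2
      simp
      field_simp
  by_cases hk2 : T.card + 1 < p
  · exact ridgeBound_shrunken hρ0 hρ1 T hk2 β
  -- At `k = p - 1` the codimension drops to two, where the inverse moment diverges; but there the
  -- bound collapses to `‖β‖²`, attained by `α = 0`.
  · have hk3 : (T.card : ℝ) = p - 1 := by
      rw [eq_sub_iff_add_eq]; exact_mod_cast (by omega : T.card + 1 = p)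
    have hp2 : (p : ℝ) - 2 ≠ 0 := by
      have : (2 : ℝ) < p := by exact_mod_cast (by omega : 2 < p)
      linarith
    convert ridgeBound_norm_sq (d := d) hp ((1 - ρ) / ρ) β using 1
    rw [hk3, show (p : ℝ) - ρ * (p - 1 - 1) - 2 = (1 - ρ) * (p - 2) by ring]
    have : 1 - ρ ≠ 0 := by linarith
    field_simp
    ring

lemma RidgeBound.mono {l C C' : ℝ} {β : EuclideanSpace ℝ (Fin p)} (h : RidgeBound d l β C)
    (hC : C ≤ C') : RidgeBound d l β C' := by
  obtain ⟨G, h1, h2, h3⟩ := h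
  exact ⟨G, h1, h2, h3.trans hC⟩

lemma ridgeBound_of_le (hp : 0 < p) {ρ : ℝ} (hρ0 : 0 < ρ) (hρ1 : ρ ≤ 1)
    (β : EuclideanSpace ℝ (Fin p)) (hpd : p ≤ d) :
    RidgeBound d ((1 - ρ) / ρ) β (p / (ρ * d + (1 - ρ) * p) * ‖β‖ ^ 2) := by
  have h := ridgeBound_gradient hp hρ0 (Finset.univ : Finset (Fin d)) β
  refine h.mono (mul_le_mul_of_nonneg_right ?_ (sq_nonneg _))
  have hp' : (1 : ℝ) ≤ p := by exact_mod_cast hp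
  have hd' : (p : ℝ) ≤ d := by exact_mod_cast hpd
  rw [Finset.card_univ, Fintype.card_fin]
  have h1 : 0 < p + ρ * (d - 1) := by nlinarith
  have h2 : 0 < ρ * d + (1 - ρ) * p := by nlinarith
  rw [one_sub_div h1.ne', div_le_div_iff₀ h1 h2]
  -- After cross-multiplication the difference of the two sides is `ρ p (p - ρ) + ρ² d`.
  nlinarith [mul_nonneg hρ0.le (mul_nonneg (by linarith : (0 : ℝ) ≤ p) (sub_nonneg.mpr
    (hρ1.trans hp'))), mul_nonneg (mul_nonneg hρ0.le hρ0.le) (by linarith : (0 : ℝ) ≤ d)]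

/-- A dual lower bound on the ridge objective. -/
lemma ridge_ge {l : ℝ} (hl : 0 < l) (c : ℝ) (w : Fin d → EuclideanSpace ℝ (Fin p))
    (β : EuclideanSpace ℝ (Fin p)) (α : Fin d → ℝ) :
    (2 * c - c ^ 2) * ‖β‖ ^ 2 - c ^ 2 / l * ∑ j, inner ℝ β (w j) ^ 2 ≤ ridge l w β α := by
  -- Two nonnegative squares, this one and `(l α j - c ⟪β, w j⟫)² / l` below, produce cross terms in
  -- `α` that cancel.
  have h1 : 0 ≤ ‖(β - ∑ j, α j • w j) - c • β‖ ^ 2 := sq_nonneg _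
  rw [norm_sub_sq_real, norm_smul, mul_pow, Real.norm_eq_abs, sq_abs, real_inner_smul_right,
    inner_sub_left, real_inner_self_eq_norm_sq, sum_inner] at h1
  have h2 : ∀ j, 2 * c * inner ℝ (α j • w j) β ≤
      l * α j ^ 2 + c ^ 2 / l * inner ℝ β (w j) ^ 2 := by
    intro j
    rw [real_inner_smul_left, real_inner_comm]
    have h3 : 0 ≤ (l * α j - c * inner ℝ β (w j)) ^ 2 / l := by positivity
    have h4 : (l * α j - c * inner ℝ β (w j)) ^ 2 / l = l * α j ^ 2 +
        c ^ 2 / l * inner ℝ β (w j) ^ 2 - 2 * c * (α j * inner ℝ β (w j)) := by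
      field_simp
      ring
    linarith
  have h5 := Finset.sum_le_sum fun j (_ : j ∈ Finset.univ) => h2 j
  rw [← Finset.mul_sum, Finset.sum_add_distrib, ← Finset.mul_sum, ← Finset.mul_sum] at h5
  unfold ridge
  linarith

/-- An integrable lower bound on the ridge objective, with an explicit mean. -/
lemma exists_le_ridge (hp : 0 < p) {ρ : ℝ} (hρ0 : 0 < ρ) (hρ1 : ρ < 1)
    (β : EuclideanSpace ℝ (Fin p)) :
    ∃ G : (Fin d → EuclideanSpace ℝ (Fin p)) → ℝ, Integrable G (weightsLaw p d) ∧
      (∀ w α, G w ≤ ridge ((1 - ρ) / ρ) w β α) ∧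
      ∫ w, G w ∂weightsLaw p d = (1 - ρ) * p / (ρ * d + (1 - ρ) * p) * ‖β‖ ^ 2 := by
  have := isProbabilityMeasure_weightsLaw hp d
  have hp' : (0 : ℝ) < p := by exact_mod_cast hp
  have hρ : 0 < 1 - ρ := by linarith
  have i1 : Integrable (fun w => ∑ j, inner ℝ β (w j) ^ 2) (weightsLaw p d) :=
    integrable_finsetSum _ fun j _ => (integral_weightsLaw_inner_sq hp j β).1
  have e1 : ∫ w, ∑ j, inner ℝ β (w j) ^ 2 ∂weightsLaw p d = d * (‖β‖ ^ 2 / p) := by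
    rw [integral_finsetSum _ fun j _ => (integral_weightsLaw_inner_sq hp j β).1]
    simp [(integral_weightsLaw_inner_sq hp _ β).2]
  -- This `c` maximises the mean `2 c - c² - c² ρ d / ((1 - ρ) p)` of the dual bound, per unit of
  -- `‖β‖²`; the maximum is `c` itself.
  set c : ℝ := (1 - ρ) * p / (ρ * d + (1 - ρ) * p) with hc
  refine ⟨fun w => (2 * c - c ^ 2) * ‖β‖ ^ 2 - c ^ 2 / ((1 - ρ) / ρ) * ∑ j, inner ℝ β (w j) ^ 2,
    (integrable_const _).sub (i1.const_mul _), fun w α => ridge_ge (div_pos hρ hρ0) c w β α, ?_⟩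
  rw [integral_sub (integrable_const _) (i1.const_mul _), integral_const_mul (c ^ 2 / ((1 - ρ) / ρ)),
    e1]
  simp only [integral_const, probReal_univ, one_smul, hc]
  have h2 : 0 < ρ * d + (1 - ρ) * p := by positivity
  field_simp
  ring

end Ridge

/-! ### Conditional laws given the weights -/

section ConditionalLaw

variable {Ω F T E : Type*} [MeasurableSpace Ω] [MeasurableSpace F] [MeasurableSpace T]
  [MeasurableSpace E]

/-- The conditional distribution given `W` of a function of `W` and of a variable independent
of `W`. -/
lemma condDistrib_comp_prod_ae_eq [StandardBorelSpace E] [Nonempty E] {μ : Measure Ω}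
    [IsFiniteMeasure μ] {W : Ω → F} {S : Ω → T} {ν : Measure F} {τ : Measure T}
    [IsProbabilityMeasure ν] [IsProbabilityMeasure τ]
    (hW : AEMeasurable W μ) (hS : AEMeasurable S μ)
    (hlaw : μ.map (fun ω => (W ω, S ω)) = ν.prod τ) {g : F × T → E} (hg : Measurable g) :
    ∀ᵐ w ∂ν, condDistrib (fun ω => g (W ω, S ω)) W μ w = τ.map (fun t => g (w, t)) := by
  -- This kernel disintegrates the joint law, and a disintegration is unique almost everywhere.
  let κ : Kernel F E := (Kernel.id ×ₖ Kernel.const F τ).map g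
  have hκ : ∀ w, κ w = τ.map (fun t => g (w, t)) := by
    intro w
    refine Measure.ext_of_lintegral _ fun f hf => ?_
    rw [Kernel.map_apply _ hg, lintegral_map hf hg, Kernel.lintegral_id_prod (f := fun q => f (g q)) (hf.comp hg),
      lintegral_map hf (by fun_prop)]
    simp
  have : IsMarkovKernel κ := Kernel.IsMarkovKernel.map _ hg
  have hWν : μ.map W = ν := by
    have h := congrArg (Measure.map Prod.fst) hlaw
    rw [AEMeasurable.map_map_of_aemeasurable (by fun_prop) (hW.prodMk hS),
      Measure.map_fst_prod, measure_univ, one_smul] at h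
    exact h
  have hWS : AEMeasurable (fun ω => (W ω, S ω)) μ := hW.prodMk hS
  have hmain := condDistrib_ae_eq_of_measure_eq_compProd (μ := μ) W
    (hg.comp_aemeasurable hWS) (κ := κ) (by
      have hm : Measurable fun q : F × T => (q.1, g q) := measurable_fst.prodMk hg
      have h1 : μ.map (fun ω => (W ω, (g ∘ fun ω => (W ω, S ω)) ω)) =
          (ν.prod τ).map (fun q => (q.1, g q)) := by
        rw [← hlaw, AEMeasurable.map_map_of_aemeasurable hm.aemeasurable hWS]
        rfl
      rw [h1, hWν]
      refine Measure.ext_of_lintegral _ fun f hf => ?_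
      rw [lintegral_map hf hm, Measure.lintegral_compProd hf,
        lintegral_prod (fun q : F × T => f (q.1, g q)) (hf.comp hm).aemeasurable]
      refine lintegral_congr fun w => ?_
      rw [hκ, lintegral_map (by fun_prop) (by fun_prop)])
  rw [hWν] at hmain
  filter_upwards [hmain] with w hw
  rw [← hκ]
  exact hw

/-- The exceptional null set does not depend on `f`. This order of quantifiers is what permits an
infimum over uncountably many predictors. -/
lemma ae_condRisk_eq [StandardBorelSpace E] [Nonempty E] {μ : Measure Ω}
    [IsFiniteMeasure μ] {W : Ω → F} {S : Ω → T} {ν : Measure F} {τ : Measure T}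
    [IsProbabilityMeasure ν] [IsProbabilityMeasure τ]
    (hW : AEMeasurable W μ) (hS : AEMeasurable S μ)
    (hlaw : μ.map (fun ω => (W ω, S ω)) = ν.prod τ) {V : F × T → E} (hV : Measurable V)
    {Y : F × T → ℝ} (hY : Measurable Y) :
    ∀ᵐ w ∂ν, ∀ f : E → ℝ, Measurable f →
      condRisk μ (fun ω => V (W ω, S ω)) (fun ω => Y (W ω, S ω)) W f w =
        ∫⁻ t, ENNReal.ofReal ((Y (w, t) - f (V (w, t))) ^ 2) ∂τ := by
  have h := condDistrib_comp_prod_ae_eq hW hS hlaw (hV.prodMk hY)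
  filter_upwards [h] with w hw f hf
  rw [condRisk, hw, lintegral_map (by fun_prop) (by fun_prop)]

end ConditionalLaw

/-! ### Joint law of the model -/

section ModelLaw

variable {Ω : Type*} [MeasurableSpace Ω] {μ : Measure Ω} {p d : ℕ}
  {Z : Ω → EuclideanSpace ℝ (Fin p)} {W : Ω → Fin d → EuclideanSpace ℝ (Fin p)}
  {ε : Ω → ℝ} {P : Ω → Fin d → Bool} {σ ρ : ℝ}

/-- The law of the latent vector and of the noise. -/
def latentNoiseLaw (p : ℕ) (σ : ℝ) : Measure (EuclideanSpace ℝ (Fin p) × ℝ) :=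
  (stdGaussian (EuclideanSpace ℝ (Fin p))).prod (gaussianReal 0 (σ ^ 2).toNNReal)

instance : IsProbabilityMeasure (latentNoiseLaw p σ) := by
  unfold latentNoiseLaw; infer_instance

lemma IsGaussianRFModel.aemeasurable_weights (h : IsGaussianRFModel μ Z W ε P σ ρ) :
    AEMeasurable W μ :=
  aemeasurable_pi_lambda _ fun j => (h.weights_law j).aemeasurable

lemma IsGaussianRFModel.map_weights [IsProbabilityMeasure μ] (h : IsGaussianRFModel μ Z W ε P σ ρ) :
    μ.map W = weightsLaw p d := by
  have h1 := (iIndepFun_iff_map_fun_eq_pi_map fun j => (h.weights_law j).aemeasurable).mp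
    h.weights_iIndep
  rw [weightsLaw]
  refine h1.trans ?_
  congr 1
  ext1 j
  exact (h.weights_law j).map_eq

/-- The weights are independent of the latent vector, the noise and the mask. -/
lemma IsGaussianRFModel.map_prod [IsProbabilityMeasure μ] (h : IsGaussianRFModel μ Z W ε P σ ρ) (hp : 0 < p) :
    μ.map (fun ω => (W ω, ((Z ω, ε ω), P ω))) =
      (weightsLaw p d).prod ((latentNoiseLaw p σ).prod (μ.map P)) := by
  have := isProbabilityMeasure_weightsLaw hp d
  have hZ := h.latent_law.aemeasurable
  have hW := h.aemeasurable_weights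
  have hε := h.noise_law.aemeasurable
  have hP := h.mask_aemeasurable
  have := Measure.isProbabilityMeasure_map hP
  -- The independence hypotheses are nested, so the joint law is factorised by adjoining `Z`, `ε`
  -- and `P` in turn.
  have h1 : μ.map (fun ω => (W ω, Z ω)) =
      (weightsLaw p d).prod (stdGaussian (EuclideanSpace ℝ (Fin p))) := by
    rw [(indepFun_iff_map_prod_eq_prod_map_map hW hZ).mp h.latent_indep.symm, h.map_weights,
      h.latent_law.map_eq]
  have h2 : μ.map (fun ω => ((W ω, Z ω), ε ω)) =
      ((weightsLaw p d).prod (stdGaussian (EuclideanSpace ℝ (Fin p)))).prod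
        (gaussianReal 0 (σ ^ 2).toNNReal) := by
    rw [← h1, ← h.noise_law.map_eq]
    exact (indepFun_iff_map_prod_eq_prod_map_map (hW.prodMk hZ) hε).mp
      (h.noise_indep.symm.comp measurable_swap measurable_id)
  have h3 : μ.map (fun ω => (W ω, (Z ω, ε ω))) =
      (weightsLaw p d).prod (latentNoiseLaw p σ) := by
    rw [latentNoiseLaw, ← Measure.prodAssoc_prod, ← h2,
      AEMeasurable.map_map_of_aemeasurable (by fun_prop) ((hW.prodMk hZ).prodMk hε)]
    rfl
  have h4 : μ.map (fun ω => ((W ω, (Z ω, ε ω)), P ω)) =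
      ((weightsLaw p d).prod (latentNoiseLaw p σ)).prod (μ.map P) := by
    rw [← h3]
    exact (indepFun_iff_map_prod_eq_prod_map_map (hW.prodMk (hZ.prodMk hε)) hP).mp
      (h.mask_indep.symm.comp (φ := fun q : EuclideanSpace ℝ (Fin p) ×
        (Fin d → EuclideanSpace ℝ (Fin p)) × ℝ => (q.2.1, (q.1, q.2.2))) (by fun_prop)
        measurable_id)
  rw [← Measure.prodAssoc_prod, ← h4,
    AEMeasurable.map_map_of_aemeasurable (by fun_prop) ((hW.prodMk (hZ.prodMk hε)).prodMk hP)]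
  rfl

/-- The mask enters the linear risk only through its first and second moments, given here and in
`integral_mask_mul`. -/
lemma IsGaussianRFModel.integral_mask [IsProbabilityMeasure μ] (h : IsGaussianRFModel μ Z W ε P σ ρ) (j : Fin d) :
    ∫ b, (if b j = true then 1 else 0 : ℝ) ∂(μ.map P) = ρ := by
  have hs : MeasurableSet {b : Fin d → Bool | b j = true} :=
    (Set.toFinite _).measurableSet
  have h1 : (fun b : Fin d → Bool => (if b j = true then 1 else 0 : ℝ)) =
      {b : Fin d → Bool | b j = true}.indicator 1 := by
    ext b; simp [Set.indicator_apply]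
  rw [h1, integral_indicator_one hs, measureReal_def,
    Measure.map_apply_of_aemeasurable h.mask_aemeasurable hs, ← h.mask_prob j]
  rfl

lemma IsGaussianRFModel.integral_mask_mul [IsProbabilityMeasure μ] (h : IsGaussianRFModel μ Z W ε P σ ρ) {i j : Fin d}
    (hij : i ≠ j) :
    ∫ b, (if b i = true then 1 else 0 : ℝ) * (if b j = true then 1 else 0) ∂(μ.map P) =
      ρ ^ 2 := by
  have hP := h.mask_aemeasurable
  rw [integral_map hP (by fun_prop)]
  have hm : Measurable fun b : Bool => (if b = true then 1 else 0 : ℝ) := by fun_prop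
  have h1 := (h.mask_iIndep.indepFun hij).comp hm hm
  have h2 := h1.integral_fun_mul_eq_mul_integral
    (hm.comp_aemeasurable ((measurable_pi_apply i).comp_aemeasurable hP)).aestronglyMeasurable
    (hm.comp_aemeasurable ((measurable_pi_apply j).comp_aemeasurable hP)).aestronglyMeasurable
  simp only [Function.comp_def] at h2
  rw [h2, sq]
  congr 1
  · rw [← h.integral_mask i, integral_map hP (by fun_prop)]
  · rw [← h.integral_mask j, integral_map hP (by fun_prop)]

end ModelLaw

/-! ### Bayes risks for fixed weights -/

section FixedWeights

variable {p d : ℕ}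

/-- The two coordinates are independent and centred, so the cross term vanishes and the variances
add. -/
lemma lintegral_latentNoiseLaw_sq (v : EuclideanSpace ℝ (Fin p)) (σ : ℝ) :
    ∫⁻ q, ENNReal.ofReal ((inner ℝ q.1 v + q.2) ^ 2) ∂latentNoiseLaw p σ =
      ENNReal.ofReal (‖v‖ ^ 2 + σ ^ 2) := by
  unfold latentNoiseLaw
  set γ := stdGaussian (EuclideanSpace ℝ (Fin p))
  set N := gaussianReal 0 (σ ^ 2).toNNReal
  let L : StrongDual ℝ (EuclideanSpace ℝ (Fin p)) := innerSL ℝ v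
  have hL : ∀ z, inner ℝ z v = L z := fun z => real_inner_comm _ _
  have m1 : MemLp L 2 γ := (IsGaussian.memLp_two_id (μ := γ)).continuousLinearMap_comp L
  have m2 : MemLp (fun e : ℝ => e) 2 N := IsGaussian.memLp_two_id (μ := N)
  have i1 : Integrable (fun z => L z ^ 2) γ := m1.integrable_sq
  have i2 : Integrable (fun e : ℝ => e ^ 2) N := m2.integrable_sq
  have e1 : ∫ z, L z ^ 2 ∂γ = ‖v‖ ^ 2 := by
    have h := variance_dual_stdGaussian L
    rw [variance_of_integral_eq_zero m1.aemeasurable (integral_strongDual_stdGaussian L),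
      innerSL_apply_norm] at h
    exact h
  have e2 : ∫ e, e ^ 2 ∂N = σ ^ 2 := by
    have h := variance_fun_id_gaussianReal (μ := 0) (v := (σ ^ 2).toNNReal)
    rw [variance_of_integral_eq_zero m2.aemeasurable (integral_id_gaussianReal),
      Real.coe_toNNReal _ (sq_nonneg σ)] at h
    exact h
  have e3 : ∫ e, e ∂N = 0 := integral_id_gaussianReal
  have j1 : Integrable (fun q : EuclideanSpace ℝ (Fin p) × ℝ => L q.1 ^ 2) (γ.prod N) :=
    i1.comp_fst N
  have j2 : Integrable (fun q : EuclideanSpace ℝ (Fin p) × ℝ => q.2 ^ 2) (γ.prod N) :=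
    i2.comp_snd γ
  have j3 : Integrable (fun q : EuclideanSpace ℝ (Fin p) × ℝ => L q.1 * q.2) (γ.prod N) :=
    (m1.integrable one_le_two).mul_prod (m2.integrable one_le_two)
  have h : (fun q : EuclideanSpace ℝ (Fin p) × ℝ => (inner ℝ q.1 v + q.2) ^ 2) =
      fun q => L q.1 ^ 2 + (2 * (L q.1 * q.2) + q.2 ^ 2) := by
    ext q; rw [hL]; ring
  have j4 : Integrable (fun q : EuclideanSpace ℝ (Fin p) × ℝ => 2 * (L q.1 * q.2) + q.2 ^ 2)
      (γ.prod N) := (j3.const_mul 2).add j2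
  have j5 : Integrable (fun q : EuclideanSpace ℝ (Fin p) × ℝ => (inner ℝ q.1 v + q.2) ^ 2)
      (γ.prod N) := by rw [h]; exact j1.add j4
  rw [← ofReal_integral_eq_lintegral_ofReal j5 (ae_of_all _ fun q => sq_nonneg _), h,
    integral_add j1 j4, integral_add (j3.const_mul 2) j2, integral_const_mul,
    integral_prod_mul (fun z => L z) (fun e : ℝ => e), e3, mul_zero, mul_zero, zero_add,
    integral_fun_fst (fun z => L z ^ 2), integral_fun_snd (fun e : ℝ => e ^ 2), e1, e2]
  simp

variable (w : Fin d → EuclideanSpace ℝ (Fin p)) (β : EuclideanSpace ℝ (Fin p)) (σ : ℝ)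

/-- No function of the features predicts better than the best linear one. -/
lemma le_lintegral_sub_sq {h : (Fin d → ℝ) → ℝ} (hh : Measurable h) :
    ENNReal.ofReal (‖orthPart w β‖ ^ 2 + σ ^ 2) ≤
      ∫⁻ q, ENNReal.ofReal ((inner ℝ q.1 β + q.2 - h fun j => inner ℝ q.1 (w j)) ^ 2)
        ∂latentNoiseLaw p σ := by
  let K := Submodule.span ℝ (Set.range w)
  -- `φ` fixes every feature and flips `⟪Z, orthPart w β⟫ + ε`. The residuals `a` and `a ∘ φ` thus
  -- have equal second moments while differing by twice that quantity, which bounds its second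
  -- moment by that of `a`.
  let φ : EuclideanSpace ℝ (Fin p) × ℝ → EuclideanSpace ℝ (Fin p) × ℝ :=
    Prod.map K.reflection (fun e => -e)
  have hφ : MeasurePreserving φ (latentNoiseLaw p σ) (latentNoiseLaw p σ) := by
    refine MeasurePreserving.prod ⟨K.reflection.continuous.measurable, ?_⟩ ⟨measurable_neg, ?_⟩
    · exact stdGaussian_map K.reflection
    · rw [gaussianReal_map_neg, neg_zero]
  let a : EuclideanSpace ℝ (Fin p) × ℝ → ℝ :=
    fun q => inner ℝ q.1 β + q.2 - h fun j => inner ℝ q.1 (w j)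
  have ha : Measurable a := by fun_prop
  have h1 : ∀ q, a q - a (φ q) = 2 * (inner ℝ q.1 (orthPart w β) + q.2) := by
    intro q
    have hw : ∀ j, inner ℝ (K.reflection q.1) (w j) = inner ℝ q.1 (w j) := by
      intro j
      have hj : K.reflection (w j) = w j :=
        Submodule.reflection_mem_subspace_eq_self (Submodule.subset_span ⟨j, rfl⟩)
      conv_lhs => rw [← hj]
      exact K.reflection.inner_map_map _ _
    have hβ : inner ℝ (K.reflection q.1) β = inner ℝ q.1 β - 2 * inner ℝ q.1 (orthPart w β) := by
      have h2 : K.reflection q.1 = q.1 - (2 : ℝ) • orthPart w q.1 := by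
        rw [Submodule.reflection_apply, two_smul ℕ, two_smul ℝ]
        have h3 : K.starProjection q.1 + orthPart w q.1 = q.1 := starProjection_add_orthPart w q.1
        rw [← sub_eq_iff_eq_add'.mpr h3.symm]
        abel
      rw [h2, inner_sub_left, real_inner_smul_left, inner_orthPart_right]
    simp only [a, φ, Prod.map_fst, Prod.map_snd, hw, hβ]
    ring
  have h2 : ∀ q, 2 * ENNReal.ofReal ((inner ℝ q.1 (orthPart w β) + q.2) ^ 2) ≤
      ENNReal.ofReal (a q ^ 2) + ENNReal.ofReal (a (φ q) ^ 2) := by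
    intro q
    rw [two_mul, ← ENNReal.ofReal_add (sq_nonneg _) (sq_nonneg _),
      ← ENNReal.ofReal_add (sq_nonneg _) (sq_nonneg _)]
    refine ENNReal.ofReal_le_ofReal ?_
    have h3 : inner ℝ q.1 (orthPart w β) + q.2 = (a q - a (φ q)) / 2 := by rw [h1]; ring
    rw [h3]
    nlinarith [sq_nonneg (a q + a (φ q))]
  have h3 := lintegral_mono (μ := latentNoiseLaw p σ) h2
  rw [lintegral_const_mul _ (by fun_prop), lintegral_add_left (by fun_prop),
    hφ.lintegral_comp (f := fun q => ENNReal.ofReal (a q ^ 2)) (by fun_prop), ← two_mul,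
    lintegral_latentNoiseLaw_sq] at h3
  exact (ENNReal.mul_le_mul_iff_right two_ne_zero ENNReal.ofNat_ne_top).mp h3

lemma lintegral_sub_linear_sq (θ : Fin d → ℝ) :
    ∫⁻ q, ENNReal.ofReal ((inner ℝ q.1 β + q.2 - (fun j => inner ℝ q.1 (w j)) ⬝ᵥ θ) ^ 2)
        ∂latentNoiseLaw p σ = ENNReal.ofReal (‖β - ∑ j, θ j • w j‖ ^ 2 + σ ^ 2) := by
  rw [← lintegral_latentNoiseLaw_sq]
  refine lintegral_congr fun q => ?_
  have h : (fun j => inner ℝ q.1 (w j)) ⬝ᵥ θ = inner ℝ q.1 (∑ j, θ j • w j) := by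
    simp [dotProduct, inner_sum, real_inner_smul_right, mul_comm]
  rw [h, inner_sub_right]
  ring_nf

/-- The Bayes risk of a linear output given the features, for fixed weights. -/
lemma iInf_lintegral_sub_sq :
    ⨅ (h : (Fin d → ℝ) → ℝ) (_ : Measurable h),
      ∫⁻ q, ENNReal.ofReal ((inner ℝ q.1 β + q.2 - h fun j => inner ℝ q.1 (w j)) ^ 2)
        ∂latentNoiseLaw p σ = ENNReal.ofReal (‖orthPart w β‖ ^ 2 + σ ^ 2) := by
  apply le_antisymm
  · obtain ⟨θ, hθ⟩ := exists_sub_sum_eq_orthPart w β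
    refine iInf₂_le_of_le (fun x => x ⬝ᵥ θ) (by unfold dotProduct; fun_prop) ?_
    rw [lintegral_sub_linear_sq w β σ θ, hθ]
  · exact le_iInf₂ fun h hh => le_lintegral_sub_sq w β σ hh

/-- The indices that are kept by a mask. -/
def maskSupport (b : Fin d → Bool) : Finset (Fin d) := Finset.univ.filter fun j => b j = true

lemma restrictTo_maskSupport (b : Fin d → Bool) (j : Fin d) :
    restrictTo (maskSupport b) w j = if b j = true then w j else 0 := by
  simp [restrictTo, maskSupport]

lemma inner_restrictTo_maskSupport (b : Fin d → Bool) (z : EuclideanSpace ℝ (Fin p)) (j : Fin d) :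
    inner ℝ z (restrictTo (maskSupport b) w j) = if b j = true then inner ℝ z (w j) else 0 := by
  rw [restrictTo_maskSupport]
  split_ifs <;> simp

variable (π : Measure (Fin d → Bool)) [IsProbabilityMeasure π]

/-- The Bayes risk given the masked features and the mask, for fixed weights. -/
lemma iInf_lintegral_masked_sub_sq :
    ⨅ (f : (Fin d → ℝ) × (Fin d → Bool) → ℝ) (_ : Measurable f),
      ∫⁻ t, ENNReal.ofReal ((inner ℝ t.1.1 β + t.1.2 -
        f (fun j => if t.2 j = true then inner ℝ t.1.1 (w j) else 0, t.2)) ^ 2)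
          ∂((latentNoiseLaw p σ).prod π) =
      ENNReal.ofReal ((∫ b, ‖orthPart (restrictTo (maskSupport b) w) β‖ ^ 2 ∂π) + σ ^ 2) := by
  have hint : ENNReal.ofReal
      ((∫ b, ‖orthPart (restrictTo (maskSupport b) w) β‖ ^ 2 ∂π) + σ ^ 2) =
      ∫⁻ b, ENNReal.ofReal (‖orthPart (restrictTo (maskSupport b) w) β‖ ^ 2 + σ ^ 2) ∂π := by
    rw [← ofReal_integral_eq_lintegral_ofReal Integrable.of_finite
      (ae_of_all _ fun b => by positivity), integral_add Integrable.of_finite (integrable_const _)]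
    simp
  simp_rw [← inner_restrictTo_maskSupport]
  have hm : ∀ f : (Fin d → ℝ) × (Fin d → Bool) → ℝ, Measurable f →
      Measurable fun t : (EuclideanSpace ℝ (Fin p) × ℝ) × (Fin d → Bool) =>
        ENNReal.ofReal ((inner ℝ t.1.1 β + t.1.2 -
          f (fun j => inner ℝ t.1.1 (restrictTo (maskSupport t.2) w j), t.2)) ^ 2) := by
    intro f hf
    have h1 : ∀ j, Measurable fun t : (EuclideanSpace ℝ (Fin p) × ℝ) × (Fin d → Bool) =>
        inner ℝ t.1.1 (restrictTo (maskSupport t.2) w j) := by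
      intro j
      refine Measurable.inner (by fun_prop) ?_
      exact (measurable_of_finite fun b : Fin d → Bool => restrictTo (maskSupport b) w j).comp
        measurable_snd
    fun_prop
  rw [hint]
  apply le_antisymm
  -- The predictor sees the mask, so it may use the optimal coefficients for each of the finitely
  -- many masks.
  · choose θ hθ using fun b : Fin d → Bool =>
      exists_sub_sum_eq_orthPart (restrictTo (maskSupport b) w) β
    have hf : Measurable fun x : (Fin d → ℝ) × (Fin d → Bool) => x.1 ⬝ᵥ θ x.2 := by
      have : Measurable θ := measurable_of_finite θ
      unfold dotProduct
      fun_prop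
    refine iInf₂_le_of_le _ hf ?_
    rw [lintegral_prod_symm _ (hm _ hf).aemeasurable]
    refine (lintegral_congr fun b => ?_).le
    have h2 := lintegral_sub_linear_sq (restrictTo (maskSupport b) w) β σ (θ b)
    rw [hθ b] at h2
    exact h2
  · refine le_iInf₂ fun f hf => ?_
    rw [lintegral_prod_symm _ (hm f hf).aemeasurable]
    refine lintegral_mono fun b => ?_
    exact le_lintegral_sub_sq _ β σ (h := fun x => f (x, b)) (by fun_prop)

end FixedWeights

/-! ### From zero imputation to ridge regression -/

section LinearRisk

variable {p d : ℕ} (w : Fin d → EuclideanSpace ℝ (Fin p)) (β : EuclideanSpace ℝ (Fin p))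
  (σ : ℝ) (π : Measure (Fin d → Bool)) [IsProbabilityMeasure π]

lemma lintegral_masked_sub_linear_sq (θ : Fin d → ℝ) :
    ∫⁻ t, ENNReal.ofReal ((inner ℝ t.1.1 β + t.1.2 -
        (fun j => if t.2 j = true then inner ℝ t.1.1 (w j) else 0) ⬝ᵥ θ) ^ 2)
          ∂((latentNoiseLaw p σ).prod π) =
      ENNReal.ofReal ((∫ b, ‖β - ∑ j, θ j • restrictTo (maskSupport b) w j‖ ^ 2 ∂π) + σ ^ 2) := by
  have hint : ENNReal.ofReal
      ((∫ b, ‖β - ∑ j, θ j • restrictTo (maskSupport b) w j‖ ^ 2 ∂π) + σ ^ 2) =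
      ∫⁻ b, ENNReal.ofReal (‖β - ∑ j, θ j • restrictTo (maskSupport b) w j‖ ^ 2 + σ ^ 2) ∂π := by
    rw [← ofReal_integral_eq_lintegral_ofReal Integrable.of_finite
      (ae_of_all _ fun b => by positivity), integral_add Integrable.of_finite (integrable_const _)]
    simp
  have hm : Measurable fun t : (EuclideanSpace ℝ (Fin p) × ℝ) × (Fin d → Bool) =>
      ENNReal.ofReal ((inner ℝ t.1.1 β + t.1.2 -
        (fun j => if t.2 j = true then inner ℝ t.1.1 (w j) else 0) ⬝ᵥ θ) ^ 2) := by
    have h1 : ∀ j, Measurable fun t : (EuclideanSpace ℝ (Fin p) × ℝ) × (Fin d → Bool) =>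
        if t.2 j = true then inner ℝ t.1.1 (w j) else 0 := fun j =>
      Measurable.ite ((by fun_prop : Measurable
        fun t : (EuclideanSpace ℝ (Fin p) × ℝ) × (Fin d → Bool) => t.2 j)
          (measurableSet_singleton true)) (by fun_prop) measurable_const
    unfold dotProduct
    fun_prop
  rw [hint, lintegral_prod_symm _ hm.aemeasurable]
  refine lintegral_congr fun b => ?_
  have h2 := lintegral_sub_linear_sq (restrictTo (maskSupport b) w) β σ θ
  simp only [inner_restrictTo_maskSupport] at h2
  exact h2

/-- Averaging over the mask turns least squares on the imputed features into ridge regression. -/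
lemma integral_norm_sq_sub_masked {ρ : ℝ} (hρ : ρ ≠ 0)
    (h1 : ∀ j, ∫ b, (if b j = true then 1 else 0 : ℝ) ∂π = ρ)
    (h2 : ∀ i j, i ≠ j →
      ∫ b, (if b i = true then 1 else 0 : ℝ) * (if b j = true then 1 else 0) ∂π = ρ ^ 2)
    (hw : ∀ j, ‖w j‖ = 1) (θ : Fin d → ℝ) :
    ∫ b, ‖β - ∑ j, θ j • restrictTo (maskSupport b) w j‖ ^ 2 ∂π =
      ridge ((1 - ρ) / ρ) w β (ρ • θ) := by
  let m : (Fin d → Bool) → Fin d → ℝ := fun b j => if b j = true then 1 else 0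
  have expand : ∀ a : Fin d → ℝ, ‖β - ∑ j, a j • w j‖ ^ 2 = ‖β‖ ^ 2 -
      2 * ∑ j, a j * inner ℝ β (w j) + ∑ i, ∑ j, a i * a j * inner ℝ (w i) (w j) := by
    intro a
    rw [norm_sub_sq_real, inner_sum, ← real_inner_self_eq_norm_sq (∑ j, a j • w j), sum_inner]
    simp_rw [inner_sum, real_inner_smul_left, real_inner_smul_right, mul_assoc]
  have hm : ∀ b, ‖β - ∑ j, θ j • restrictTo (maskSupport b) w j‖ ^ 2 = ‖β‖ ^ 2 -
      2 * ∑ j, m b j * (θ j * inner ℝ β (w j)) +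
        ∑ i, ∑ j, (m b i * m b j) * (θ i * θ j * inner ℝ (w i) (w j)) := by
    intro b
    have h3 : ∀ j, θ j • restrictTo (maskSupport b) w j = (m b j * θ j) • w j := by
      intro j
      rw [restrictTo_maskSupport]
      simp only [m]
      split_ifs <;> simp
    simp_rw [h3]
    rw [expand]
    congr 1
    · congr 2
      exact Finset.sum_congr rfl fun j _ => by ring
    · exact Finset.sum_congr rfl fun i _ => Finset.sum_congr rfl fun j _ => by ring
  -- The excess `ρ (1 - ρ)` on the diagonal creates the penalty: as `‖w j‖ = 1`, it contributes `ρ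
  -- (1 - ρ) θ j² = ((1 - ρ) / ρ) (ρ θ j)²`.
  have hmm : ∀ i j, ∫ b, m b i * m b j ∂π = ρ ^ 2 + if i = j then ρ * (1 - ρ) else 0 := by
    intro i j
    split_ifs with hij
    · subst hij
      have h3 : ∀ b, m b i * m b i = m b i := fun b => by
        simp only [m]; split_ifs <;> simp
      simp_rw [h3]
      exact (h1 i).trans (by ring)
    · rw [add_zero]
      exact h2 i j hij
  have e1 : ∫ b, ∑ j, m b j * (θ j * inner ℝ β (w j)) ∂π = ∑ j, ρ * (θ j * inner ℝ β (w j)) := by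
    rw [integral_finsetSum _ fun _ _ => Integrable.of_finite]
    refine Finset.sum_congr rfl fun j _ => ?_
    rw [integral_mul_const]
    congr 1
    exact h1 j
  have e2 : ∫ b, ∑ i, ∑ j, (m b i * m b j) * (θ i * θ j * inner ℝ (w i) (w j)) ∂π =
      ∑ i, ∑ j, (ρ ^ 2 + if i = j then ρ * (1 - ρ) else 0) *
        (θ i * θ j * inner ℝ (w i) (w j)) := by
    rw [integral_finsetSum _ fun _ _ => Integrable.of_finite]
    refine Finset.sum_congr rfl fun i _ => ?_
    rw [integral_finsetSum _ fun _ _ => Integrable.of_finite]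
    refine Finset.sum_congr rfl fun j _ => ?_
    rw [integral_mul_const, hmm]
  simp_rw [hm]
  rw [integral_add Integrable.of_finite Integrable.of_finite,
    integral_sub Integrable.of_finite Integrable.of_finite, integral_const_mul, e1, e2, ridge,
    expand]
  simp_rw [add_mul, Finset.sum_add_distrib, ite_mul, zero_mul, Finset.sum_ite_eq,
    Finset.mem_univ, if_true, real_inner_self_eq_norm_sq, hw]
  simp only [integral_const, probReal_univ, Pi.smul_apply, smul_eq_mul]
  have e3 : ∑ i, ∑ j, ρ * θ i * (ρ * θ j) * inner ℝ (w i) (w j) =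
      ∑ i, ∑ j, ρ ^ 2 * (θ i * θ j * inner ℝ (w i) (w j)) :=
    Finset.sum_congr rfl fun i _ => Finset.sum_congr rfl fun j _ => by ring
  have e4 : (1 - ρ) / ρ * ∑ j, (ρ * θ j) ^ 2 = ∑ j, ρ * (1 - ρ) * (θ j * θ j * 1 ^ 2) := by
    rw [Finset.mul_sum]
    refine Finset.sum_congr rfl fun j _ => ?_
    field_simp
  rw [e3, e4]
  simp_rw [mul_assoc]
  ring

/-- The infimum is uncountable, but its terms are continuous in `w`, so it is upper semicontinuous.
-/
lemma measurable_iInf_ridge (l : ℝ) :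
    Measurable fun w : Fin d → EuclideanSpace ℝ (Fin p) =>
      ⨅ α : Fin d → ℝ, ENNReal.ofReal (ridge l w β α + σ ^ 2) := by
  refine UpperSemicontinuous.measurable (upperSemicontinuous_iInf fun α => ?_)
  refine (ENNReal.continuous_ofReal.comp ?_).upperSemicontinuous
  unfold ridge
  fun_prop

lemma ridge_nonneg {l : ℝ} (hl : 0 ≤ l) (α : Fin d → ℝ) : 0 ≤ ridge l w β α :=
  add_nonneg (sq_nonneg _) (mul_nonneg hl (Finset.sum_nonneg fun _ _ => sq_nonneg _))

lemma iInf_ridge_le (l : ℝ) :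
    ⨅ α : Fin d → ℝ, ENNReal.ofReal (ridge l w β α + σ ^ 2) ≤
      ENNReal.ofReal (‖β‖ ^ 2 + σ ^ 2) :=
  iInf_le_of_le 0 (by simp [ridge])

lemma integrable_toReal_iInf_ridge (hp : 0 < p) (l : ℝ) :
    Integrable (fun w => (⨅ α : Fin d → ℝ, ENNReal.ofReal (ridge l w β α + σ ^ 2)).toReal)
      (weightsLaw p d) := by
  have := isProbabilityMeasure_weightsLaw hp d
  refine Integrable.of_bound (measurable_iInf_ridge β σ l).ennreal_toReal.aestronglyMeasurable
    (‖β‖ ^ 2 + σ ^ 2) (ae_of_all _ fun w => ?_)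
  rw [Real.norm_of_nonneg ENNReal.toReal_nonneg]
  exact ENNReal.toReal_le_of_le_ofReal (by positivity) (iInf_ridge_le w β σ l)

lemma RidgeBound.integral_le (hp : 0 < p) {l C : ℝ} (hl : 0 ≤ l)
    {β : EuclideanSpace ℝ (Fin p)} (h : RidgeBound d l β C) (σ : ℝ) :
    ∫ w, (⨅ α : Fin d → ℝ, ENNReal.ofReal (ridge l w β α + σ ^ 2)).toReal ∂weightsLaw p d ≤
      C + σ ^ 2 := by
  have := isProbabilityMeasure_weightsLaw hp d
  obtain ⟨G, h1, h2, h3⟩ := h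
  have h4 : ∫ w, (G w + σ ^ 2) ∂weightsLaw p d ≤ C + σ ^ 2 := by
    rw [integral_add h1 (integrable_const _)]
    simpa using h3
  refine le_trans (integral_mono_ae (integrable_toReal_iInf_ridge β σ hp l)
    (h1.add (integrable_const _)) ?_) h4
  filter_upwards [h2] with w ⟨α, hα⟩
  have hG : 0 ≤ G w + σ ^ 2 := add_nonneg ((ridge_nonneg w β hl α).trans hα) (sq_nonneg _)
  refine ENNReal.toReal_le_of_le_ofReal hG (iInf_le_of_le α (ENNReal.ofReal_le_ofReal ?_))
  exact add_le_add_left hα _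

lemma le_integral_iInf_ridge (hp : 0 < p) {ρ : ℝ} (hρ0 : 0 < ρ) (hρ1 : ρ < 1) :
    (1 - ρ) * p / (ρ * d + (1 - ρ) * p) * ‖β‖ ^ 2 + σ ^ 2 ≤
      ∫ w, (⨅ α : Fin d → ℝ, ENNReal.ofReal (ridge ((1 - ρ) / ρ) w β α + σ ^ 2)).toReal
        ∂weightsLaw p d := by
  have := isProbabilityMeasure_weightsLaw hp d
  obtain ⟨G, h1, h2, h3⟩ := exists_le_ridge (d := d) hp hρ0 hρ1 β
  have h4 : ∫ w, (G w + σ ^ 2) ∂weightsLaw p d =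
      (1 - ρ) * p / (ρ * d + (1 - ρ) * p) * ‖β‖ ^ 2 + σ ^ 2 := by
    rw [integral_add h1 (integrable_const _), h3]
    simp
  rw [← h4]
  refine integral_mono (h1.add (integrable_const _)) (integrable_toReal_iInf_ridge β σ hp _) ?_
  intro w
  refine (ENNReal.ofReal_le_iff_le_toReal ?_).mp ?_
  · exact ((iInf_ridge_le w β σ _).trans_lt ENNReal.ofReal_lt_top).ne
  · refine le_iInf fun α => ENNReal.ofReal_le_ofReal ?_
    have := h2 w α
    linarith

lemma le_integral_iInf_ridge_of_nonneg (hp : 0 < p) {l : ℝ} (hl : 0 ≤ l) :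
    σ ^ 2 ≤ ∫ w, (⨅ α : Fin d → ℝ, ENNReal.ofReal (ridge l w β α + σ ^ 2)).toReal
        ∂weightsLaw p d := by
  have := isProbabilityMeasure_weightsLaw hp d
  have h4 : ∀ w : Fin d → EuclideanSpace ℝ (Fin p),
      σ ^ 2 ≤ (⨅ α : Fin d → ℝ, ENNReal.ofReal (ridge l w β α + σ ^ 2)).toReal := by
    intro w
    refine (ENNReal.ofReal_le_iff_le_toReal ?_).mp ?_
    · exact ((iInf_ridge_le w β σ _).trans_lt ENNReal.ofReal_lt_top).ne
    · exact le_iInf fun α => ENNReal.ofReal_le_ofReal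
        (le_add_of_nonneg_left (ridge_nonneg w β hl α))
  have h5 := integral_mono (integrable_const (σ ^ 2)) (integrable_toReal_iInf_ridge β σ hp l) h4
  simpa using h5

end LinearRisk

/-! ### The risks as functions of the weights -/

section RiskFormulas

variable {Ω : Type*} [MeasurableSpace Ω] {μ : Measure Ω} [IsProbabilityMeasure μ] {p d : ℕ}
  {Z : Ω → EuclideanSpace ℝ (Fin p)} {W : Ω → Fin d → EuclideanSpace ℝ (Fin p)}
  {ε : Ω → ℝ} {P : Ω → Fin d → Bool} {σ ρ : ℝ}

lemma IsGaussianRFModel.ae_of_ae_weightsLaw (h : IsGaussianRFModel μ Z W ε P σ ρ)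
    {q : (Fin d → EuclideanSpace ℝ (Fin p)) → Prop} (hq : ∀ᵐ w ∂weightsLaw p d, q w) :
    ∀ᵐ ω ∂μ, q (W ω) :=
  ae_of_ae_map h.aemeasurable_weights (by rwa [h.map_weights])

lemma IsGaussianRFModel.riskComplete_ae_eq (h : IsGaussianRFModel μ Z W ε P σ ρ) (hp : 0 < p)
    (β : EuclideanSpace ℝ (Fin p)) :
    riskComplete μ Z W ε β =ᵐ[μ] fun ω => ENNReal.ofReal (‖orthPart (W ω) β‖ ^ 2 + σ ^ 2) := by
  have := isProbabilityMeasure_weightsLaw hp d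
  have := Measure.isProbabilityMeasure_map h.mask_aemeasurable
  have hS : AEMeasurable (fun ω => ((Z ω, ε ω), P ω)) μ :=
    (h.latent_law.aemeasurable.prodMk h.noise_law.aemeasurable).prodMk h.mask_aemeasurable
  have hr := ae_condRisk_eq h.aemeasurable_weights hS (h.map_prod hp)
    (V := fun q => fun j => inner ℝ q.2.1.1 (q.1 j)) (by fun_prop)
    (Y := fun q => inner ℝ q.2.1.1 β + q.2.1.2) (by fun_prop)
  refine h.ae_of_ae_weightsLaw (q := fun w => condBayesRisk μ (features Z W) (output Z β ε) W w =
    ENNReal.ofReal (‖orthPart w β‖ ^ 2 + σ ^ 2)) ?_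
  filter_upwards [hr] with w hw
  rw [← iInf_lintegral_sub_sq]
  refine iInf_congr fun f => iInf_congr fun hf => (hw f hf).trans ?_
  have hm : Measurable fun q : EuclideanSpace ℝ (Fin p) × ℝ =>
      ENNReal.ofReal ((inner ℝ q.1 β + q.2 - f fun j => inner ℝ q.1 (w j)) ^ 2) := by fun_prop
  exact (measurePreserving_fst (μ := latentNoiseLaw p σ) (ν := μ.map P)).lintegral_comp hm

lemma measurable_imputedFeatures :
    Measurable fun q : (Fin d → EuclideanSpace ℝ (Fin p)) ×
      ((EuclideanSpace ℝ (Fin p) × ℝ) × (Fin d → Bool)) =>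
        fun j => if q.2.2 j = true then inner ℝ q.2.1.1 (q.1 j) else 0 :=
  measurable_pi_lambda _ fun j =>
    Measurable.ite ((by fun_prop : Measurable fun q : (Fin d → EuclideanSpace ℝ (Fin p)) ×
      ((EuclideanSpace ℝ (Fin p) × ℝ) × (Fin d → Bool)) => q.2.2 j)
        (measurableSet_singleton true)) (by fun_prop) measurable_const

lemma IsGaussianRFModel.riskMiss_ae_eq (h : IsGaussianRFModel μ Z W ε P σ ρ) (hp : 0 < p)
    (β : EuclideanSpace ℝ (Fin p)) :
    riskMiss μ Z W ε P β =ᵐ[μ] fun ω => ENNReal.ofReal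
      ((∫ b, ‖orthPart (restrictTo (maskSupport b) (W ω)) β‖ ^ 2 ∂(μ.map P)) + σ ^ 2) := by
  have := isProbabilityMeasure_weightsLaw hp d
  have := Measure.isProbabilityMeasure_map h.mask_aemeasurable
  have hS : AEMeasurable (fun ω => ((Z ω, ε ω), P ω)) μ :=
    (h.latent_law.aemeasurable.prodMk h.noise_law.aemeasurable).prodMk h.mask_aemeasurable
  have hr := ae_condRisk_eq h.aemeasurable_weights hS (h.map_prod hp)
    (V := fun q => (fun j => if q.2.2 j = true then inner ℝ q.2.1.1 (q.1 j) else 0, q.2.2))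
    (measurable_imputedFeatures.prodMk (by fun_prop))
    (Y := fun q => inner ℝ q.2.1.1 β + q.2.1.2) (by fun_prop)
  refine h.ae_of_ae_weightsLaw (q := fun w => condBayesRisk μ
    (fun ω' => (imputed (features Z W) P ω', P ω')) (output Z β ε) W w = ENNReal.ofReal
      ((∫ b, ‖orthPart (restrictTo (maskSupport b) w) β‖ ^ 2 ∂(μ.map P)) + σ ^ 2)) ?_
  filter_upwards [hr] with w hw
  rw [← iInf_lintegral_masked_sub_sq]
  exact iInf_congr fun f => iInf_congr fun hf => hw f hf

lemma IsGaussianRFModel.riskImp_ae_eq (h : IsGaussianRFModel μ Z W ε P σ ρ) (hp : 0 < p)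
    (hρ : ρ ≠ 0) (β : EuclideanSpace ℝ (Fin p)) :
    riskImp μ Z W ε P β =ᵐ[μ] fun ω =>
      ⨅ α : Fin d → ℝ, ENNReal.ofReal (ridge ((1 - ρ) / ρ) (W ω) β α + σ ^ 2) := by
  have := isProbabilityMeasure_weightsLaw hp d
  have := Measure.isProbabilityMeasure_map h.mask_aemeasurable
  have hS : AEMeasurable (fun ω => ((Z ω, ε ω), P ω)) μ :=
    (h.latent_law.aemeasurable.prodMk h.noise_law.aemeasurable).prodMk h.mask_aemeasurable
  have hr := ae_condRisk_eq h.aemeasurable_weights hS (h.map_prod hp)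
    (V := fun q => fun j => if q.2.2 j = true then inner ℝ q.2.1.1 (q.1 j) else 0)
    measurable_imputedFeatures
    (Y := fun q => inner ℝ q.2.1.1 β + q.2.1.2) (by fun_prop)
  refine h.ae_of_ae_weightsLaw (q := fun w => condLinearRisk μ (imputed (features Z W) P)
    (output Z β ε) W w = ⨅ α : Fin d → ℝ,
      ENNReal.ofReal (ridge ((1 - ρ) / ρ) w β α + σ ^ 2)) ?_
  filter_upwards [hr, ae_weightsLaw_norm_eq_one hp] with w hw hw1
  -- As `ρ ≠ 0`, minimising over `θ` is the same as minimising over `α = ρ θ`.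
  have hs : Function.Surjective fun θ : Fin d → ℝ => ρ • θ := fun α => ⟨ρ⁻¹ • α, by simp [hρ]⟩
  rw [← hs.iInf_comp]
  refine iInf_congr fun θ => (hw _ (by unfold dotProduct; fun_prop)).trans ?_
  rw [← integral_norm_sq_sub_masked w β (μ.map P) hρ h.integral_mask
    (fun i j hij => h.integral_mask_mul hij) hw1 θ]
  exact lintegral_masked_sub_linear_sq w β σ (μ.map P) θ

/-- A bounded measurable function of the weights has finite expectation, computed under the law of
the weights. -/
lemma IsGaussianRFModel.hasFiniteExpectation (h : IsGaussianRFModel μ Z W ε P σ ρ)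
    {R : Ω → ℝ≥0∞} {r : (Fin d → EuclideanSpace ℝ (Fin p)) → ℝ≥0∞} (hr : Measurable r) {C : ℝ}
    (hC : ∀ w, r w ≤ ENNReal.ofReal C) (hR : R =ᵐ[μ] fun ω => r (W ω)) :
    HasFiniteExpectation μ R ∧ Integrable (fun ω => (R ω).toReal) μ ∧
      ∫ ω, (R ω).toReal ∂μ = ∫ w, (r w).toReal ∂weightsLaw p d := by
  have h1 : AEMeasurable R μ := (hr.comp_aemeasurable h.aemeasurable_weights).congr hR.symm
  have h2 : ∫⁻ ω, R ω ∂μ ≠ ⊤ := by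
    rw [lintegral_congr_ae hR]
    refine ((lintegral_mono fun ω => hC (W ω)).trans_lt ?_).ne
    simp
  refine ⟨⟨h1, h2⟩, integrable_toReal_of_lintegral_ne_top h1 h2, ?_⟩
  rw [← h.map_weights, integral_map h.aemeasurable_weights
    hr.ennreal_toReal.aestronglyMeasurable]
  refine integral_congr_ae ?_
  filter_upwards [hR] with ω hω
  rw [hω]

end RiskFormulas

/-! ### Expected risks -/

section Expectations

variable {Ω : Type*} [MeasurableSpace Ω] {μ : Measure Ω} [IsProbabilityMeasure μ] {p d : ℕ}
  {Z : Ω → EuclideanSpace ℝ (Fin p)} {W : Ω → Fin d → EuclideanSpace ℝ (Fin p)}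
  {ε : Ω → ℝ} {P : Ω → Fin d → Bool} {σ ρ : ℝ}

lemma restrictTo_univ (w : Fin d → EuclideanSpace ℝ (Fin p)) :
    restrictTo Finset.univ w = w := by
  ext1 j; simp [restrictTo]

lemma measurable_orthPart_restrictTo_left (T : Finset (Fin d)) (β : EuclideanSpace ℝ (Fin p)) :
    Measurable fun w : Fin d → EuclideanSpace ℝ (Fin p) => orthPart (restrictTo T w) β := by
  have h : Measurable fun w : Fin d → EuclideanSpace ℝ (Fin p) => (restrictTo T w, β) :=
    (measurable_restrictTo T).prodMk measurable_const
  exact measurable_orthPart.comp h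

lemma norm_sq_orthPart_le (w : Fin d → EuclideanSpace ℝ (Fin p)) (β : EuclideanSpace ℝ (Fin p)) :
    ‖orthPart w β‖ ^ 2 ≤ ‖β‖ ^ 2 := by
  gcongr
  exact norm_orthPart_le w β

lemma IsGaussianRFModel.hasFiniteExpectation_riskComplete
    (h : IsGaussianRFModel μ Z W ε P σ ρ) (hp : 0 < p) (β : EuclideanSpace ℝ (Fin p)) :
    HasFiniteExpectation μ (riskComplete μ Z W ε β) ∧
      Integrable (fun ω => (riskComplete μ Z W ε β ω).toReal) μ ∧
      ∫ ω, (riskComplete μ Z W ε β ω).toReal ∂μ =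
        ∫ w, (‖orthPart w β‖ ^ 2 + σ ^ 2) ∂weightsLaw p d := by
  have hm : Measurable fun w : Fin d → EuclideanSpace ℝ (Fin p) =>
      ENNReal.ofReal (‖orthPart w β‖ ^ 2 + σ ^ 2) := by
    have := (measurable_orthPart_restrictTo_left (Finset.univ : Finset (Fin d)) β)
    simp only [restrictTo_univ] at this
    exact ((this.norm.pow_const 2).add_const _).ennreal_ofReal
  obtain ⟨h1, h2, h3⟩ := h.hasFiniteExpectation hm (C := ‖β‖ ^ 2 + σ ^ 2)
    (fun w => ENNReal.ofReal_le_ofReal (add_le_add_left (norm_sq_orthPart_le w β) _))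
    (h.riskComplete_ae_eq hp β)
  refine ⟨h1, h2, h3.trans (integral_congr_ae (ae_of_all _ fun w => ?_))⟩
  exact ENNReal.toReal_ofReal (by positivity)

lemma IsGaussianRFModel.hasFiniteExpectation_riskMiss
    (h : IsGaussianRFModel μ Z W ε P σ ρ) (hp : 0 < p) (β : EuclideanSpace ℝ (Fin p)) :
    HasFiniteExpectation μ (riskMiss μ Z W ε P β) ∧
      Integrable (fun ω => (riskMiss μ Z W ε P β ω).toReal) μ ∧
      ∫ ω, (riskMiss μ Z W ε P β ω).toReal ∂μ =
        ∫ w, ((∫ b, ‖orthPart (restrictTo (maskSupport b) w) β‖ ^ 2 ∂(μ.map P)) + σ ^ 2)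
          ∂weightsLaw p d := by
  have := Measure.isProbabilityMeasure_map h.mask_aemeasurable
  have hm : Measurable fun w : Fin d → EuclideanSpace ℝ (Fin p) =>
      ENNReal.ofReal ((∫ b, ‖orthPart (restrictTo (maskSupport b) w) β‖ ^ 2 ∂(μ.map P)) +
        σ ^ 2) := by
    simp_rw [integral_fintype Integrable.of_finite, smul_eq_mul]
    refine (Measurable.add_const (Finset.measurable_sum _ fun b _ => ?_) _).ennreal_ofReal
    exact ((measurable_orthPart_restrictTo_left _ β).norm.pow_const 2).const_mul _
  have hle : ∀ w : Fin d → EuclideanSpace ℝ (Fin p),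
      ∫ b, ‖orthPart (restrictTo (maskSupport b) w) β‖ ^ 2 ∂(μ.map P) ≤ ‖β‖ ^ 2 := by
    intro w
    have := integral_mono (μ := μ.map P) Integrable.of_finite (integrable_const (‖β‖ ^ 2))
      fun b => norm_sq_orthPart_le (restrictTo (maskSupport b) w) β
    simpa using this
  obtain ⟨h1, h2, h3⟩ := h.hasFiniteExpectation hm (C := ‖β‖ ^ 2 + σ ^ 2)
    (fun w => ENNReal.ofReal_le_ofReal (add_le_add_left (hle w) _))
    (h.riskMiss_ae_eq hp β)
  refine ⟨h1, h2, h3.trans (integral_congr_ae (ae_of_all _ fun w => ?_))⟩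
  exact ENNReal.toReal_ofReal (add_nonneg (integral_nonneg fun b => sq_nonneg _) (sq_nonneg _))

lemma IsGaussianRFModel.hasFiniteExpectation_riskImp
    (h : IsGaussianRFModel μ Z W ε P σ ρ) (hp : 0 < p) (hρ : ρ ≠ 0)
    (β : EuclideanSpace ℝ (Fin p)) :
    HasFiniteExpectation μ (riskImp μ Z W ε P β) ∧
      Integrable (fun ω => (riskImp μ Z W ε P β ω).toReal) μ ∧
      ∫ ω, (riskImp μ Z W ε P β ω).toReal ∂μ =
        ∫ w, (⨅ α : Fin d → ℝ, ENNReal.ofReal (ridge ((1 - ρ) / ρ) w β α + σ ^ 2)).toReal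
          ∂weightsLaw p d :=
  h.hasFiniteExpectation (measurable_iInf_ridge β σ _)
    (fun w => iInf_ridge_le w β σ _) (h.riskImp_ae_eq hp hρ β)

lemma IsGaussianRFModel.integral_riskComplete_of_le
    (h : IsGaussianRFModel μ Z W ε P σ ρ) (hp : 0 < p) (β : EuclideanSpace ℝ (Fin p))
    (hd : d ≤ p) :
    ∫ ω, (riskComplete μ Z W ε β ω).toReal ∂μ = (p - d) / p * ‖β‖ ^ 2 + σ ^ 2 := by
  have := isProbabilityMeasure_weightsLaw hp d
  obtain ⟨h1, h2⟩ := integral_weightsLaw_norm_sq_orthPart hp (Finset.univ : Finset (Fin d))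
    (by simpa using hd) β
  simp only [restrictTo_univ, Finset.card_univ, Fintype.card_fin] at h1 h2
  rw [(h.hasFiniteExpectation_riskComplete hp β).2.2, integral_add h1 (integrable_const _), h2]
  simp

lemma IsGaussianRFModel.integral_riskComplete_of_ge
    (h : IsGaussianRFModel μ Z W ε P σ ρ) (hp : 0 < p) (β : EuclideanSpace ℝ (Fin p))
    (hd : p ≤ d) :
    ∫ ω, (riskComplete μ Z W ε β ω).toReal ∂μ = σ ^ 2 := by
  have := isProbabilityMeasure_weightsLaw hp d
  have h1 : ∀ᵐ w ∂weightsLaw p d, ‖orthPart w β‖ ^ 2 + σ ^ 2 = σ ^ 2 := by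
    filter_upwards [ae_inGeneralPosition hp] with w hw
    rw [(orthPart_eq_zero_iff w).mpr (by rw [hw.span_eq_top hd]; trivial)]
    simp
  rw [(h.hasFiniteExpectation_riskComplete hp β).2.2, integral_congr_ae h1]
  simp

/-- When `d ≤ p`, the mean squared distance is affine in the number of kept features for every mask,
and that number has mean `ρ d`. -/
lemma IsGaussianRFModel.integral_riskMiss_of_le
    (h : IsGaussianRFModel μ Z W ε P σ ρ) (hp : 0 < p) (β : EuclideanSpace ℝ (Fin p))
    (hd : d ≤ p) :
    ∫ ω, (riskMiss μ Z W ε P β ω).toReal ∂μ = (p - ρ * d) / p * ‖β‖ ^ 2 + σ ^ 2 := by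
  have := isProbabilityMeasure_weightsLaw hp d
  have := Measure.isProbabilityMeasure_map h.mask_aemeasurable
  have hT := fun b : Fin d → Bool => integral_weightsLaw_norm_sq_orthPart hp (maskSupport b)
    ((Finset.card_le_univ _).trans (by simpa using hd)) β
  have hcard : ∫ b, ((maskSupport b).card : ℝ) ∂(μ.map P) = ρ * d := by
    have h1 : ∀ b : Fin d → Bool, ((maskSupport b).card : ℝ) =
        ∑ j, if b j = true then (1 : ℝ) else 0 := by
      intro b; simp [maskSupport]
    simp_rw [h1]
    rw [integral_finsetSum _ fun _ _ => Integrable.of_finite]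
    simp [h.integral_mask, mul_comm]
  rw [(h.hasFiniteExpectation_riskMiss hp β).2.2]
  simp_rw [integral_fintype (μ := μ.map P) Integrable.of_finite, smul_eq_mul]
  have h2 : ∀ b ∈ (Finset.univ : Finset (Fin d → Bool)), Integrable (fun w =>
      (μ.map P).real {b} * ‖orthPart (restrictTo (maskSupport b) w) β‖ ^ 2) (weightsLaw p d) :=
    fun b _ => (hT b).1.const_mul _
  rw [integral_add (integrable_finsetSum _ h2) (integrable_const _), integral_finsetSum _ h2]
  simp_rw [integral_const_mul, (hT _).2, ← smul_eq_mul ((μ.map P).real _)]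
  rw [← integral_fintype (μ := μ.map P)
    (f := fun b => (p - (maskSupport b).card : ℝ) / p * ‖β‖ ^ 2) Integrable.of_finite,
    integral_mul_const, integral_div, integral_sub (integrable_const _) Integrable.of_finite, hcard]
  simp

end Expectations

end RFImputation

end

/-! ### Assembly of the two regimes -/

theorem theorem2p3 {Ω : Type*} [MeasurableSpace Ω] (μ : Measure Ω) [IsProbabilityMeasure μ]
    (p d : ℕ) (hp : 0 < p) (β : EuclideanSpace ℝ (Fin p)) (σ ρ : ℝ) (hρ0 : 0 < ρ) (hρ1 : ρ ≤ 1)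
    (Z : Ω → EuclideanSpace ℝ (Fin p)) (W : Ω → Fin d → EuclideanSpace ℝ (Fin p))
    (ε : Ω → ℝ) (P : Ω → Fin d → Bool)
    (hmodel : RFImputation.IsGaussianRFModel μ Z W ε P σ ρ) :
    RFImputation.HasFiniteExpectation μ (RFImputation.riskComplete μ Z W ε β) ∧
    RFImputation.HasFiniteExpectation μ (RFImputation.riskMiss μ Z W ε P β) ∧
    RFImputation.HasFiniteExpectation μ (RFImputation.riskImp μ Z W ε P β) ∧
    (d < p →
      (∫ ω, (RFImputation.riskImp μ Z W ε P β ω).toReal ∂μ) - σ ^ 2 ≤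
          (⨅ k : Fin (d + 1), (((p : ℝ) - ρ * (k : ℕ)) / p +
            (1 - ρ) * ρ * (((k : ℕ) : ℝ) - 1) / ((p : ℝ) - ρ * (((k : ℕ) : ℝ) - 1) - 2) *
              (((k : ℕ) : ℝ) / p))) * ‖β‖ ^ 2 ∧
      RFImputation.deltaImpMiss μ Z W ε P β ≤
          (1 - ρ) * ρ * ((d : ℝ) - 1) / ((p : ℝ) - ρ * ((d : ℝ) - 1) - 2) *
            ((d : ℝ) / p) * ‖β‖ ^ 2 ∧
      (1 - ρ) * ρ * ((d : ℝ) - 1) / ((p : ℝ) - ρ * ((d : ℝ) - 1) - 2) *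
            ((d : ℝ) / p) * ‖β‖ ^ 2 =
          ρ * ((d : ℝ) - 1) / ((p : ℝ) - ρ * ((d : ℝ) - 1) - 2) *
            RFImputation.deltaMiss μ Z W ε P β) ∧
    (p ≤ d →
      (∫ ω, (RFImputation.riskImp μ Z W ε P β ω).toReal ∂μ) - σ ^ 2 ≤
          (p : ℝ) / (ρ * d + (1 - ρ) * p) * ‖β‖ ^ 2 ∧
      (1 - ρ) * p / (ρ * d + (1 - ρ) * p) * ‖β‖ ^ 2 ≤
          RFImputation.deltaImpMiss μ Z W ε P β + RFImputation.deltaMiss μ Z W ε P β ∧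
      RFImputation.deltaImpMiss μ Z W ε P β + RFImputation.deltaMiss μ Z W ε P β ≤
          (p : ℝ) / (ρ * d + (1 - ρ) * p) * ‖β‖ ^ 2) := by
  have hp' : (p : ℝ) ≠ 0 := by exact_mod_cast hp.ne'
  have hl : 0 ≤ (1 - ρ) / ρ := div_nonneg (by linarith) hρ0.le
  obtain ⟨c1, c2, c3⟩ := hmodel.hasFiniteExpectation_riskComplete hp β
  obtain ⟨m1, m2, m3⟩ := hmodel.hasFiniteExpectation_riskMiss hp β
  obtain ⟨i1, i2, i3⟩ := hmodel.hasFiniteExpectation_riskImp hp hρ0.ne' β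
  have hmiss : RFImputation.deltaMiss μ Z W ε P β =
      ∫ ω, (RFImputation.riskMiss μ Z W ε P β ω).toReal ∂μ -
        ∫ ω, (RFImputation.riskComplete μ Z W ε β ω).toReal ∂μ := integral_sub m2 c2
  have himp : RFImputation.deltaImpMiss μ Z W ε P β =
      ∫ ω, (RFImputation.riskImp μ Z W ε P β ω).toReal ∂μ -
        ∫ ω, (RFImputation.riskMiss μ Z W ε P β ω).toReal ∂μ := integral_sub i2 m2
  refine ⟨c1, m1, i1, fun hd => ?_, fun hd => ?_⟩
  · have hk : ∀ k : ℕ, k ≤ d → (∫ ω, (RFImputation.riskImp μ Z W ε P β ω).toReal ∂μ) - σ ^ 2 ≤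
        (((p : ℝ) - ρ * k) / p + (1 - ρ) * ρ * ((k : ℝ) - 1) /
          ((p : ℝ) - ρ * ((k : ℝ) - 1) - 2) * ((k : ℝ) / p)) * ‖β‖ ^ 2 := by
      intro k hkd
      rw [i3, sub_le_iff_le_add]
      exact (RFImputation.ridgeBound_of_lt hρ0 hρ1 β hkd (hkd.trans_lt hd)).integral_le hp hl σ
    have hM := hmodel.integral_riskMiss_of_le hp β hd.le
    have hC := hmodel.integral_riskComplete_of_le hp β hd.le
    refine ⟨?_, ?_, ?_⟩
    · obtain ⟨k, hk'⟩ := exists_eq_ciInf_of_finite (f := fun k : Fin (d + 1) =>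
        (((p : ℝ) - ρ * (k : ℕ)) / p + (1 - ρ) * ρ * (((k : ℕ) : ℝ) - 1) /
          ((p : ℝ) - ρ * (((k : ℕ) : ℝ) - 1) - 2) * (((k : ℕ) : ℝ) / p)))
      rw [← hk']
      exact hk k (Nat.lt_succ_iff.mp k.2)
    -- The leading term `(p - ρ d) / p` of the bound at `k = d` is the mean excess of `riskMiss`
    -- over `σ²`; subtracting it leaves the claim.
    · have h := hk d le_rfl
      rw [himp, hM]
      linarith
    -- The difference of the two means is `(1 - ρ) d / p * ‖β‖²`.
    · rw [hmiss, hM, hC]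
      field_simp
      ring
  -- Here the weights almost surely span the space, so the sum of the two gaps telescopes to the
  -- mean of `riskImp` minus `σ²`.
  · have hC := hmodel.integral_riskComplete_of_ge hp β hd
    have hu := (RFImputation.ridgeBound_of_le hp hρ0 hρ1 β hd).integral_le hp hl σ
    rw [← i3] at hu
    refine ⟨by linarith, ?_, by rw [himp, hmiss, hC]; linarith⟩
    rw [himp, hmiss, hC, i3]
    -- The dual bound divides by the penalty and so excludes `ρ = 1`, where the left side is `0` and
    -- nonnegativity of the objective suffices.
    rcases eq_or_lt_of_le hρ1 with rfl | hρ
    · have h := RFImputation.le_integral_iInf_ridge_of_nonneg (d := d) β σ hp hl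
      simp only [sub_self, zero_mul, zero_div] at h ⊢
      linarith
    · have h := RFImputation.le_integral_iInf_ridge (d := d) β σ hp hρ0 hρ
      linarith
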